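/- Let $A=\mathbb{Q}\langle x_1,\dots,x_n \mid x_jx_i=c_{ij}x_ix_j+d_{ij},\ 1\le i<j\le n\rangle$ be a $G$-algebra whose relations have integer coefficients: the $c_{ij}$ are nonzero integers, the $d_{ij}$ are $\mathbb{Z}$-linear combinations of standard monomials $x^\alpha=x_1^{\alpha_1}\cdots x_n^{\alpha_n}$, there is a monomial ordering $>$ (a total, translation invariant well-ordering of $\mathbb{N}^n$) that is admissible, i.e. $d_{ij}=0$ or $\epsilon_i+\epsilon_j>\exp(d_{ij})$ for all $i<j$, and for all $i<j<k$ the element $$c_{ik}c_{jk}d_{ij}x_k-x_kd_{ij}+c_{jk}x_jd_{ik}-c_{ij}d_{ik}x_j+d_{jk}x_i-c_{ij}c_{ik}x_id_{jk}$$ of the free algebra reduces to zero by the rewriting rules $x_jx_i\to c_{ij}x_ix_j+d_{ij}$. Here $\exp(f)$ denotes the leading exponent with respect to $>$ of $f\neq 0$, written as a linear combination of standard monomials, and $\exp(S)=\{\exp(f)\mid f\in S\setminus\{0\}\}$. Fix an admissible monomial ordering $>$ for $A$. Let $A_0\subset A$ be the set of elements with integer coefficients. For a prime $p$, let $A_p=\mathbb{F}_p\langle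 x_1,\dots,x_n\mid C_p\rangle$, where $C_p$ is obtained from the above relations by reducing all coefficients modulo $p$. For $f\in A_0$ let $f_p\in A_p$ be obtained by reducing the coefficients of $f$ modulo $p$. Consider the condition $(*)$ $p$ divides neither any $c_{ij}$ nor any nonzero coefficient of any $d_{ij}$ $(i<j)$; if it holds, $A_p$ is a $G$-algebra over $\mathbb{F}_p$ for which $>$ is admissible. Let $I\subset A$ be a nonzero left ideal, and let $f_1,\dots,f_r\in A_0$ be generators of $I$. Define the left ideals $$I_p=\langle f_p\mid f\in I\cap A_0\rangle\subset A_p,\qquad \widetilde I_p=\langle (f_1)_p,\dots,(f_r)_p\rangle\subset A_p,$$ and let $\mathcal{G}(0)$ and $\mathcal{G}(p)$ be the reduced left Gröbner bases of $I$ and of $\widetilde I_p$ with respect to $>$. A prime $p$ satisfying $(*)$ is called lucky if $I_p=\widetilde I_p$ and $\exp(\mathcal{G}(0))=\exp(\mathcal{G}(p))$. **Lemma.** Only finitely many primes are unlucky. That is, all but finitely many primes $p$ satisfy $(*)$, $I_p=\widetilde I_p$ and $\exp(\mathcal{G}(0))=\exp(\mathcal{G}(p))$. -/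

import Mathlib

open scoped MonomialOrder

noncomputable section

namespace GAlg

/-- The free associative algebra `R⟨x₁, …, xₙ⟩`: the monoid algebra of the free monoid of words. -/
abbrev Free (R : Type) [CommRing R] (n : ℕ) : Type :=
  MonoidAlgebra R (FreeMonoid (Fin n))

/-- A word, regarded as an element of the free associative algebra. -/
def word (R : Type) [CommRing R] {n : ℕ} (w : FreeMonoid (Fin n)) : Free R n :=
  MonoidAlgebra.of R (FreeMonoid (Fin n)) w

/-- The indeterminate `x i`. -/
def X (R : Type) [CommRing R] {n : ℕ} (i : Fin n) : Free R n :=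
  word R (FreeMonoid.of i)

/-- The standard monomial `x₁ ^ α₁ ⋯ xₙ ^ αₙ`, a word with factors in increasing order. -/
def stdWord {n : ℕ} (α : Fin n →₀ ℕ) : FreeMonoid (Fin n) :=
  (List.ofFn fun i : Fin n => FreeMonoid.of i ^ α i).prod

/-- Standard polynomials, that is, linear combinations of standard monomials. A standard polynomial
is stored as its coefficient family `ℕⁿ →₀ R`, in the form of an `MvPolynomial`. Only the linear
structure (coefficients, support, leading exponent) of `MvPolynomial` is used, never its
commutative product. -/
abbrev StdPoly (R : Type) [CommRing R] (n : ℕ) : Type :=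
  MvPolynomial (Fin n) R

/-- The standard polynomial `∑ c_α x^α` as an element of the free associative algebra. -/
def StdPoly.toFree (R : Type) [CommRing R] (n : ℕ) : StdPoly R n →ₗ[R] Free R n :=
  (MvPolynomial.basisMonomials (Fin n) R).constr R fun α => word R (stdWord α)

/-- Data of commutation relations `x_j x_i = c_{ij} x_i x_j + d_{ij}`, `i < j`, where the `d_{ij}`
are standard polynomials. The values at pairs with `j ≤ i` are never used. -/
structure CommRel (R : Type) [CommRing R] (n : ℕ) where
  c : Fin n → Fin n → R
  d : Fin n → Fin n → StdPoly R n

namespace CommRel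

/-- Apply a ring homomorphism to all coefficients of the commutation relations. -/
def map {R S : Type} [CommRing R] [CommRing S] {n : ℕ} (φ : R →+* S) (D : CommRel R n) :
    CommRel S n where
  c i j := φ (D.c i j)
  d i j := MvPolynomial.map φ (D.d i j)

section

variable {R : Type} [CommRing R] {n : ℕ} (D : CommRel R n)

/-- `d_{ij}` as an element of the free associative algebra. -/
def dFree (i j : Fin n) : Free R n := StdPoly.toFree R n (D.d i j)

/-- The commutation relations, as a relation on the free associative algebra. -/
inductive Rel : Free R n → Free R n → Prop
  | comm (i j : Fin n) (h : i < j) :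
      Rel (X R j * X R i) (D.c i j • (X R i * X R j) + D.dFree i j)

/-- The algebra `R⟨x₁, …, xₙ ∣ x_j x_i = c_{ij} x_i x_j + d_{ij}, i < j⟩`. -/
abbrev Alg : Type := RingQuot D.Rel

/-- The element `∑ c_α x^α` of the algebra that is given by a standard polynomial. -/
def std : StdPoly R n →ₗ[R] D.Alg :=
  (RingQuot.mkAlgHom R D.Rel).toLinearMap ∘ₗ StdPoly.toFree R n

/-- One reduction step in the free algebra: for some words `u`, `v` and some `i < j`, the occurrence
of the word `u x_j x_i v` in `f` (with its coefficient) is rewritten by means of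
`x_j x_i → c_{ij} x_i x_j + d_{ij}`. All other words of `f` are left alone. -/
def Step (f g : Free R n) : Prop :=
  ∃ (u v : FreeMonoid (Fin n)) (i j : Fin n), i < j ∧
    g = f - f.coeff (u * FreeMonoid.of j * FreeMonoid.of i * v) •
      (word R u * (X R j * X R i - (D.c i j • (X R i * X R j) + D.dFree i j)) * word R v)

/-- `f` reduces to zero with respect to the relations. -/
def ReducesToZero (f : Free R n) : Prop := Relation.ReflTransGen D.Step f 0

/-- The element whose reduction to zero is the nondegeneracy condition for `i < j < k`. -/
def nondeg (i j k : Fin n) : Free R n :=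
  (D.c i k * D.c j k) • (D.dFree i j * X R k) - X R k * D.dFree i j
    + D.c j k • (X R j * D.dFree i k) - D.c i j • (D.dFree i k * X R j)
    + D.dFree j k * X R i - (D.c i j * D.c i k) • (X R i * D.dFree j k)

/-- The monomial ordering `m` is admissible: `d_{ij} = 0` or `ε_i + ε_j > exp(d_{ij})` for `i < j`.
(A `MonomialOrder` is a total, translation invariant well-ordering of `ℕⁿ`.) -/
def IsAdmissible (m : MonomialOrder (Fin n)) : Prop :=
  ∀ i j : Fin n, i < j →
    D.d i j = 0 ∨ m.degree (D.d i j) ≺[m] (Finsupp.single i 1 + Finsupp.single j 1)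

/-- The relations define a `G`-algebra. -/
structure IsGAlgebra : Prop where
  c_ne_zero : ∀ i j : Fin n, i < j → D.c i j ≠ 0
  exists_admissible : ∃ m : MonomialOrder.{0, 0} (Fin n), D.IsAdmissible m
  nondegenerate : ∀ i j k : Fin n, i < j → j < k → D.ReducesToZero (D.nondeg i j k)

/-- `exp(S) = {exp(f) ∣ f ∈ S ∖ {0}}` for a subset `S` of the algebra. Here `exp(f)` is the leading
exponent of the standard polynomial `q` that represents `f`; in a `G`-algebra, `q` is unique. -/
def exps (m : MonomialOrder (Fin n)) (S : Set D.Alg) : Set (Fin n →₀ ℕ) :=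
  {α | ∃ f ∈ S, f ≠ 0 ∧ ∃ q : StdPoly R n, D.std q = f ∧ m.degree q = α}

/-- `G` is a (left) Gröbner basis of the left ideal `I`: it is a finite subset of `I ∖ {0}` with
`exp(I) = ⋃ (exp(g) + ℕⁿ)`, the union being over `g ∈ G`. (For the zero ideal this says that `G` is
empty.) Note that `Ideal` means left ideal. -/
structure IsGroebnerBasis (m : MonomialOrder (Fin n)) (I : Ideal D.Alg) (G : Set D.Alg) :
    Prop where
  finite : G.Finite
  subset : G ⊆ {f | f ∈ I ∧ f ≠ 0}
  exps_eq : D.exps m (I : Set D.Alg) = {α | ∃ β ∈ D.exps m G, ∃ γ : Fin n →₀ ℕ, α = β + γ}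

/-- `G` is a reduced (left) Gröbner basis of `I`: a Gröbner basis whose elements have leading
coefficient `1` and such that no exponent in the Newton diagram of a `g ∈ G` lies in
`exp(h) + ℕⁿ` for an `h ∈ G` other than `g`. -/
structure IsReducedGroebnerBasis (m : MonomialOrder (Fin n)) (I : Ideal D.Alg) (G : Set D.Alg) :
    Prop extends D.IsGroebnerBasis m I G where
  reduced : ∀ g ∈ G, ∃ q : StdPoly R n, D.std q = g ∧ m.leadingCoeff q = 1 ∧
    ∀ h ∈ G, h ≠ g → ∀ α ∈ q.support, ∀ β ∈ D.exps m {h}, ¬ ∃ γ : Fin n →₀ ℕ, α = β + γ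

end

section Integral

/-! Commutation relations with integer coefficients, and reduction modulo `N`. -/

variable {n : ℕ} (D : CommRel ℤ n)

/-- The relations, considered over `ℚ`. -/
abbrev rat : CommRel ℚ n := D.map (Int.castRingHom ℚ)

/-- The relations `C_N`, reduced modulo `N`. -/
abbrev red (N : ℕ) : CommRel (ZMod N) n := D.map (Int.castRingHom (ZMod N))

/-- `N` divides neither any `c_{ij}` nor any (nonzero) coefficient of any `d_{ij}`. -/
def Star (N : ℕ) : Prop :=
  ∀ i j : Fin n, i < j → ¬ (N : ℤ) ∣ D.c i j ∧
    ∀ α ∈ (D.d i j).support, ¬ (N : ℤ) ∣ (D.d i j).coeff α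

/-- `A₀`, the set of elements of `A = D.rat.Alg` with integer coefficients. -/
def integral : Set D.rat.Alg :=
  {f | ∃ q : StdPoly ℤ n, D.rat.std (MvPolynomial.map (Int.castRingHom ℚ) q) = f}

/-- `g = f_N`: the element `f` of `A` has integer coefficients, and mapping these coefficients to
`ℤ/N` gives the element `g` of `A_N`. -/
def IsReduction (N : ℕ) (f : D.rat.Alg) (g : (D.red N).Alg) : Prop :=
  ∃ q : StdPoly ℤ n, D.rat.std (MvPolynomial.map (Int.castRingHom ℚ) q) = f ∧
    (D.red N).std (MvPolynomial.map (Int.castRingHom (ZMod N)) q) = g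

/-- The left ideal of `A_N` that is generated by the reductions `f_N` of the elements `f` of `S` with
integer coefficients. -/
def reductionSpan (N : ℕ) (S : Set D.rat.Alg) : Ideal (D.red N).Alg :=
  Ideal.span {g | ∃ f ∈ S ∩ D.integral, D.IsReduction N f g}

/-- The reduction `I_N = ⟨f_N ∣ f ∈ I ∩ A₀⟩` of a left ideal `I` of `A`. -/
def idealRed (N : ℕ) (I : Ideal D.rat.Alg) : Ideal (D.red N).Alg :=
  D.reductionSpan N (I : Set D.rat.Alg)

/-- The left ideal `Ĩ_N = ⟨(f₁)_N, …, (f_r)_N⟩` of `A_N`. -/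
def idealTilde (N : ℕ) {r : ℕ} (f : Fin r → D.rat.Alg) : Ideal (D.red N).Alg :=
  D.reductionSpan N (Set.range f)

/-- The prime `p` is lucky for the left ideal `I` with the chosen generators `f₁, …, f_r`:
`I_p = Ĩ_p`, and the reduced Gröbner bases `𝒢(0)` of `I` and `𝒢(p)` of `Ĩ_p` (which exist) satisfy
`exp(𝒢(0)) = exp(𝒢(p))`. -/
structure IsLucky (m : MonomialOrder (Fin n)) (I : Ideal D.rat.Alg) {r : ℕ}
    (f : Fin r → D.rat.Alg) (p : ℕ) : Prop where
  ideal_eq : D.idealRed p I = D.idealTilde p f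
  exists_zero : ∃ G₀ : Set D.rat.Alg, D.rat.IsReducedGroebnerBasis m I G₀
  exists_p : ∃ Gp : Set (D.red p).Alg, (D.red p).IsReducedGroebnerBasis m (D.idealTilde p f) Gp
  exps_eq : ∀ (G₀ : Set D.rat.Alg) (Gp : Set (D.red p).Alg),
    D.rat.IsReducedGroebnerBasis m I G₀ →
    (D.red p).IsReducedGroebnerBasis m (D.idealTilde p f) Gp →
    D.rat.exps m G₀ = (D.red p).exps m Gp

end Integral

end CommRel

end GAlg

end

/-! Let `J` be the left ideal generated by the integral generators inside the algebra over ℤ with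
the same relations. By Dickson's lemma the set `E` of exponents of `I` has finitely many minimal
elements β. Clearing denominators gives, for each β, an element of `J` with leading term a_β x^β,
where a_β is a nonzero integer. The good primes are those dividing no a_β, no c_{ij} and no nonzero
coefficient of a d_{ij}; all but finitely many primes are good.

Let p be good. Multiplying by x^γ changes a leading coefficient only by a product of the c_{ij}, so
every exponent in `E` is the leading exponent of an element of `J` whose leading coefficient is
prime to p. Pseudo-division of an integral element of `I` by such elements uses only multipliers
that are invertible mod p (`map_mem_and_degree_mem`). Hence its reduction lies in Ĩ_p, and the
exponent of a nonzero reduction lies in `E`. The first fact gives I_p = Ĩ_p. As Ĩ_p is the image of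
`J`, the second gives exp(Ĩ_p) = `E` (`exps_eq_of_forall_exists`). The exponents of a reduced
Gröbner basis are the minimal exponents of its ideal, so they agree as well.

Exponents make sense only if standard monomials are linearly independent, over ℚ and over 𝔽_p. This
is `std_injective`, proved by Bergman's diamond lemma: the only overlaps of left hand sides are x_k
x_j x_i with i < j < k, and the nondegeneracy condition resolves exactly these. -/

open scoped MonomialOrder

noncomputable section

namespace GAlg

/-! ### Words, inversions and the termination order of the rewriting. -/

section Words

variable {n : ℕ}

/-- The exponent of a word: the number of occurrences of each letter. -/
def wdeg (w : FreeMonoid (Fin n)) : Fin n →₀ ℕ :=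
  Multiplicative.toAdd
    (FreeMonoid.lift (fun i : Fin n => Multiplicative.ofAdd (Finsupp.single i 1)) w)

@[simp] theorem wdeg_one : wdeg (1 : FreeMonoid (Fin n)) = 0 := by simp [wdeg]

@[simp] theorem wdeg_mul (u v : FreeMonoid (Fin n)) : wdeg (u * v) = wdeg u + wdeg v := by
  simp [wdeg]

@[simp] theorem wdeg_of (i : Fin n) : wdeg (FreeMonoid.of i) = Finsupp.single i 1 := by
  simp [wdeg]

theorem wdeg_apply (w : FreeMonoid (Fin n)) (i : Fin n) : wdeg w i = w.toList.count i := by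
  induction w using FreeMonoid.recOn with
  | one => simp
  | of_mul x xs ih =>
    rw [wdeg_mul, Finsupp.add_apply, ih, wdeg_of, FreeMonoid.toList_of_mul, List.count_cons,
      add_comm, Finsupp.single_apply]
    simp

theorem perm_of_wdeg_eq {u v : FreeMonoid (Fin n)} (h : wdeg u = wdeg v) :
    u.toList.Perm v.toList := by
  rw [List.perm_iff_count]
  intro i
  rw [← wdeg_apply, ← wdeg_apply, h]

/-- The number of inversions of a list. -/
def inversions : List (Fin n) → ℕ
  | [] => 0
  | a :: l => l.countP (· < a) + inversions l

theorem inversions_append (u v : List (Fin n)) :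
    inversions (u ++ v)
      = inversions u + inversions v + (u.map fun a => v.countP (· < a)).sum := by
  induction u with
  | nil => simp [inversions]
  | cons a u ih => simp [inversions, ih]; ring

/-- Inversions between the middle block and its surroundings depend only on the multiset of its
letters, so a permutation of the block changes only its inner inversions. -/
theorem inversions_lt_of_perm {z z' : List (Fin n)} (hp : z.Perm z')
    (h : inversions z < inversions z') (a b : List (Fin n)) :
    inversions (a ++ z ++ b) < inversions (a ++ z' ++ b) := by
  have e1 : (a.map fun x => z.countP (· < x)) = a.map fun x => z'.countP (· < x) :=
    List.map_congr_left fun x _ => hp.countP_eq _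
  have e2 : ((a ++ z).map fun x => b.countP (· < x)).sum
      = ((a ++ z').map fun x => b.countP (· < x)).sum :=
    ((hp.append_left a).map _).sum_eq
  rw [inversions_append (a ++ z), inversions_append (a ++ z'), inversions_append a,
    inversions_append a, e1, e2]
  omega

theorem inversions_eq_zero_iff (l : List (Fin n)) :
    inversions l = 0 ↔ l.Pairwise (· ≤ ·) := by
  induction l with
  | nil => simp [inversions]
  | cons a l ih => simp [inversions, ih, List.countP_eq_zero]

theorem stdWord_toList (α : Fin n →₀ ℕ) :
    (stdWord α).toList = (List.ofFn fun i : Fin n => List.replicate (α i) i).flatten := by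
  rw [stdWord, FreeMonoid.toList_prod, List.map_ofFn]
  congr 2
  funext i
  simp only [Function.comp]
  induction α i with
  | zero => simp
  | succ k ih => rw [pow_succ', FreeMonoid.toList_of_mul, ih, List.replicate_succ]

theorem stdWord_pairwise (α : Fin n →₀ ℕ) : (stdWord α).toList.Pairwise (· ≤ ·) := by
  rw [stdWord_toList, List.pairwise_flatten]
  constructor
  · intro l hl
    rw [List.mem_ofFn] at hl
    obtain ⟨i, rfl⟩ := hl
    exact List.pairwise_replicate.2 (Or.inr le_rfl)
  · rw [List.pairwise_ofFn]
    intro i j hij x hx y hy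
    rw [List.eq_of_mem_replicate hx, List.eq_of_mem_replicate hy]
    exact hij.le

@[simp] theorem wdeg_stdWord (α : Fin n →₀ ℕ) : wdeg (stdWord α) = α := by
  ext j
  rw [wdeg_apply, stdWord_toList, List.count_flatten, List.map_ofFn, List.sum_ofFn]
  simp [Function.comp, List.count_replicate]

theorem eq_stdWord_of_pairwise {w : FreeMonoid (Fin n)} (h : w.toList.Pairwise (· ≤ ·)) :
    w = stdWord (wdeg w) := by
  apply FreeMonoid.toList.injective
  refine List.Perm.eq_of_pairwise (fun a b _ _ h1 h2 => le_antisymm h1 h2) h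
    (stdWord_pairwise _) (perm_of_wdeg_eq ?_)
  rw [wdeg_stdWord]

/-- `w = u x_j x_i v` with `i < j`, so that a commutation relation applies. -/
def IsRedex (w u v : FreeMonoid (Fin n)) (i j : Fin n) : Prop :=
  i < j ∧ w = u * FreeMonoid.of j * FreeMonoid.of i * v

theorem inversions_swap {i j : Fin n} (h : i < j) (u v : List (Fin n)) :
    inversions (u ++ [i, j] ++ v) < inversions (u ++ [j, i] ++ v) :=
  inversions_lt_of_perm (List.Perm.swap _ _ _) (by simp [inversions, h, h.le]) u v

theorem not_isRedex_stdWord (α : Fin n →₀ ℕ) (u v : FreeMonoid (Fin n)) (i j : Fin n) :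
    ¬ IsRedex (stdWord α) u v i j := by
  rintro ⟨hij, h⟩
  have h0 := (inversions_eq_zero_iff _).2 (stdWord_pairwise α)
  have h1 := inversions_swap hij u.toList v.toList
  rw [h] at h0
  simp [FreeMonoid.toList_mul] at h0 h1
  omega

theorem exists_isRedex {w : FreeMonoid (Fin n)} (hw : ¬ w.toList.Pairwise (· ≤ ·)) :
    ∃ u v i j, IsRedex w u v i j := by
  rw [← List.isChain_iff_pairwise, List.isChain_iff_forall_rel_of_append_cons_cons] at hw
  push Not at hw
  obtain ⟨a, b, l₁, l₂, h, hab⟩ := hw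
  refine ⟨FreeMonoid.ofList l₁, FreeMonoid.ofList l₂, b, a, hab, ?_⟩
  apply FreeMonoid.toList.injective
  simp [h, FreeMonoid.toList_mul]

variable (m : MonomialOrder (Fin n))

/-- Words are compared by their exponents first, then by their numbers of inversions. -/
def wkey (w : FreeMonoid (Fin n)) : m.syn ×ₗ ℕ := toLex (m.toSyn (wdeg w), inversions w.toList)

theorem wkey_lt_iff {z w : FreeMonoid (Fin n)} :
    wkey m z < wkey m w ↔ m.toSyn (wdeg z) < m.toSyn (wdeg w) ∨
      wdeg z = wdeg w ∧ inversions z.toList < inversions w.toList := by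
  simp [wkey, Prod.Lex.lt_iff]

theorem wkey_wf : WellFounded fun z w : FreeMonoid (Fin n) => wkey m z < wkey m w :=
  InvImage.wf (wkey m) wellFounded_lt

variable {m}

theorem wkey_lt_of_wdeg_lt {z w : FreeMonoid (Fin n)}
    (h : m.toSyn (wdeg z) < m.toSyn (wdeg w)) : wkey m z < wkey m w :=
  (wkey_lt_iff m).2 (Or.inl h)

/-- Exponents add under concatenation; in a tie of exponents the two words are permutations of each
other, so their inversions can be compared in context. -/
theorem wkey_mul_lt {z w : FreeMonoid (Fin n)} (h : wkey m z < wkey m w)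
    (a b : FreeMonoid (Fin n)) : wkey m (a * z * b) < wkey m (a * w * b) := by
  rw [wkey_lt_iff] at h ⊢
  rcases h with h | ⟨h, h'⟩
  · left
    simp only [wdeg_mul, map_add]
    gcongr
  · right
    refine ⟨by simp [h], ?_⟩
    simp only [FreeMonoid.toList_mul]
    exact inversions_lt_of_perm (perm_of_wdeg_eq h) h' _ _

theorem wkey_swap_lt {i j : Fin n} (h : i < j) :
    wkey m (FreeMonoid.of i * FreeMonoid.of j) < wkey m (FreeMonoid.of j * FreeMonoid.of i) := by
  rw [wkey_lt_iff]
  right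
  refine ⟨by simp [add_comm], ?_⟩
  simpa using inversions_swap h [] []

end Words

/-! ### Linear maps on the free algebra, tested on words. -/

section Linear

variable {R : Type} [CommRing R] {n : ℕ}

theorem word_mul (u v : FreeMonoid (Fin n)) : word R (u * v) = word R u * word R v :=
  map_mul _ _ _

theorem word_one : word R (1 : FreeMonoid (Fin n)) = 1 := map_one _

theorem map_mem_of_mem_supported {M : Type*} [AddCommGroup M] [Module R M]
    (L : Free R n →ₗ[R] M) (T : Submodule R M) {S : Set (FreeMonoid (Fin n))}
    (h : ∀ z ∈ S, L (word R z) ∈ T) {f : Free R n} (hf : f ∈ MonoidAlgebra.supported R R S) :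
    L f ∈ T := by
  rw [MonoidAlgebra.supported_eq_span_single] at hf
  have : Submodule.span R ((fun w => MonoidAlgebra.single w (1 : R)) '' S) ≤ T.comap L := by
    rw [Submodule.span_le]
    rintro _ ⟨z, hz, rfl⟩
    exact h z hz
  exact this hf

theorem map_eq_of_mem_supported {M : Type*} [AddCommGroup M] [Module R M]
    (L L' : Free R n →ₗ[R] M) {S : Set (FreeMonoid (Fin n))}
    (h : ∀ z ∈ S, L (word R z) = L' (word R z)) {f : Free R n}
    (hf : f ∈ MonoidAlgebra.supported R R S) : L f = L' f := by
  have := map_mem_of_mem_supported (L - L') ⊥ (S := S)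
    (fun z hz => by simp [h z hz]) hf
  simpa [sub_eq_zero] using this

theorem word_mem_supported {S : Set (FreeMonoid (Fin n))} {w : FreeMonoid (Fin n)} (h : w ∈ S) :
    word R w ∈ MonoidAlgebra.supported R R S := by
  rw [MonoidAlgebra.supported_eq_span_single]
  exact Submodule.subset_span ⟨w, h, rfl⟩

theorem sandwich_mem_supported {S T : Set (FreeMonoid (Fin n))} (a b : FreeMonoid (Fin n))
    (h : ∀ z ∈ S, a * z * b ∈ T) {f : Free R n} (hf : f ∈ MonoidAlgebra.supported R R S) :
    word R a * f * word R b ∈ MonoidAlgebra.supported R R T := by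
  refine map_mem_of_mem_supported (LinearMap.mulLeftRight R (word R a, word R b)) _
    (fun z hz => ?_) hf
  rw [LinearMap.mulLeftRight_apply, ← word_mul, ← word_mul]
  exact word_mem_supported (h z hz)

theorem map_mem_of_mem_restrictSupport {M : Type*} [AddCommGroup M] [Module R M]
    (L : StdPoly R n →ₗ[R] M) (T : Submodule R M) {S : Set (Fin n →₀ ℕ)}
    (h : ∀ α ∈ S, L (MvPolynomial.monomial α 1) ∈ T) {q : StdPoly R n}
    (hq : q ∈ MvPolynomial.restrictSupport R S) : L q ∈ T := by
  rw [MvPolynomial.restrictSupport_eq_span] at hq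
  have : Submodule.span R ((fun α => MvPolynomial.monomial α (1 : R)) '' S) ≤ T.comap L := by
    rw [Submodule.span_le]
    rintro _ ⟨z, hz, rfl⟩
    exact h z hz
  exact this hq

theorem toFree_monomial (α : Fin n →₀ ℕ) (c : R) :
    StdPoly.toFree R n (MvPolynomial.monomial α c) = c • word R (stdWord α) := by
  have : MvPolynomial.monomial α c = c • MvPolynomial.basisMonomials (Fin n) R α := by
    simp [MvPolynomial.smul_monomial]
  rw [this, map_smul, StdPoly.toFree, Module.Basis.constr_basis]

theorem toFree_mem_supported {S : Set (Fin n →₀ ℕ)} {T : Set (FreeMonoid (Fin n))}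
    (h : ∀ α ∈ S, stdWord α ∈ T) {q : StdPoly R n}
    (hq : q ∈ MvPolynomial.restrictSupport R S) :
    StdPoly.toFree R n q ∈ MonoidAlgebra.supported R R T :=
  map_mem_of_mem_restrictSupport _ _
    (fun α hα => by rw [toFree_monomial, one_smul]; exact word_mem_supported (h α hα)) hq

/-- The linear extension of a function on words to the free algebra. -/
def extend {M : Type*} [AddCommGroup M] [Module R M] (F : FreeMonoid (Fin n) → M) :
    Free R n →ₗ[R] M :=
  (MonoidAlgebra.basis (FreeMonoid (Fin n)) R).constr R F

@[simp] theorem extend_word {M : Type*} [AddCommGroup M] [Module R M]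
    (F : FreeMonoid (Fin n) → M) (w : FreeMonoid (Fin n)) :
    extend (R := R) F (word R w) = F w := by
  have : word R w = MonoidAlgebra.basis (FreeMonoid (Fin n)) R w := by
    rw [MonoidAlgebra.basis_apply]; rfl
  rw [this, extend, Module.Basis.constr_basis]

end Linear

/-! ### The diamond lemma: standard monomials are linearly independent. -/

namespace CommRel

variable {R : Type} [CommRing R] {n : ℕ} (D : CommRel R n) (m : MonomialOrder (Fin n))

/-- The right hand side of the rule `x_j x_i → c_{ij} x_i x_j + d_{ij}`. -/
def rhs (i j : Fin n) : Free R n := D.c i j • (X R i * X R j) + D.dFree i j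

/-- The relation `x_j x_i - (c_{ij} x_i x_j + d_{ij})`. -/
def rel (i j : Fin n) : Free R n := X R j * X R i - D.rhs i j

theorem X_mul_X (i j : Fin n) :
    X R j * X R i = word R (FreeMonoid.of j * FreeMonoid.of i) := (word_mul _ _).symm

variable {D m}

theorem d_mem (hm : D.IsAdmissible m) {i j : Fin n} (h : i < j) :
    D.d i j ∈ MvPolynomial.restrictSupport R
      {α | α ≺[m] (Finsupp.single i 1 + Finsupp.single j 1)} := by
  rcases hm i j h with h0 | h0
  · rw [h0]; exact zero_mem _
  · intro α hα
    exact (m.le_degree hα).trans_lt h0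

theorem dFree_mem (hm : D.IsAdmissible m) {i j : Fin n} (h : i < j) :
    D.dFree i j ∈ MonoidAlgebra.supported R R
      {z | wdeg z ≺[m] (Finsupp.single i 1 + Finsupp.single j 1)} :=
  toFree_mem_supported (fun α hα => by simpa using hα) (d_mem hm h)

theorem sandwich_dFree_mem (hm : D.IsAdmissible m) {i j : Fin n} (h : i < j)
    (a b w : FreeMonoid (Fin n))
    (hw : wdeg w = wdeg a + (Finsupp.single i 1 + Finsupp.single j 1) + wdeg b) :
    word R a * D.dFree i j * word R b ∈
      MonoidAlgebra.supported R R {z | wkey m z < wkey m w} := by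
  refine sandwich_mem_supported a b (fun z hz => wkey_lt_of_wdeg_lt ?_) (dFree_mem hm h)
  rw [hw]
  simp only [wdeg_mul, map_add, Set.mem_ofPred_eq] at hz ⊢
  gcongr

theorem rhs_mem (hm : D.IsAdmissible m) {i j : Fin n} (h : i < j) :
    D.rhs i j ∈ MonoidAlgebra.supported R R
      {z | wkey m z < wkey m (FreeMonoid.of j * FreeMonoid.of i)} := by
  refine Submodule.add_mem _ (Submodule.smul_mem _ _ ?_) ?_
  · rw [X_mul_X]
    exact word_mem_supported (wkey_swap_lt h)
  · simpa [word_one] using sandwich_dFree_mem hm h 1 1 (FreeMonoid.of j * FreeMonoid.of i)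
      (by simp [add_comm])

theorem sandwich_rhs_mem (hm : D.IsAdmissible m) {i j : Fin n} (h : i < j)
    (a b : FreeMonoid (Fin n)) :
    word R a * D.rhs i j * word R b ∈ MonoidAlgebra.supported R R
      {z | wkey m z < wkey m (a * FreeMonoid.of j * FreeMonoid.of i * b)} :=
  sandwich_mem_supported a b
    (fun z hz => by simpa only [mul_assoc, Set.mem_ofPred_eq] using wkey_mul_lt hz a b)
    (rhs_mem hm h)

variable (D m)

open Classical in
/-- The recursion step in the construction of the normal form of a word. -/
def nfStep (w : FreeMonoid (Fin n))
    (F : ∀ z : FreeMonoid (Fin n), wkey m z < wkey m w → StdPoly R n) : StdPoly R n :=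
  if h : ∃ u v i j, IsRedex w u v i j then
    -- For admissible relations every word of the rewritten element is smaller than `w`, so the
    -- value 0 is never used.
    extend (R := R) (fun z => if hz : wkey m z < wkey m w then F z hz else 0)
      (word R h.choose * D.rhs h.choose_spec.choose_spec.choose
        h.choose_spec.choose_spec.choose_spec.choose * word R h.choose_spec.choose)
  else MvPolynomial.monomial (wdeg w) 1

/-- The normal form of a word. -/
def nfWord : FreeMonoid (Fin n) → StdPoly R n := (wkey_wf m).fix (D.nfStep m)

/-- The normal form of an element of the free algebra with respect to the rewriting rules
`x_j x_i → c_{ij} x_i x_j + d_{ij}`, for a fixed choice of a rule for each word. -/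
def nf : Free R n →ₗ[R] StdPoly R n := extend (D.nfWord m)

variable {D m}

theorem nf_of_not_redex {w : FreeMonoid (Fin n)} (h : ∀ u v i j, ¬ IsRedex w u v i j) :
    D.nf m (word R w) = MvPolynomial.monomial (wdeg w) 1 := by
  rw [nf, extend_word, nfWord, WellFounded.fix_eq, nfStep, dif_neg]
  rintro ⟨u, v, i, j, h'⟩
  exact h u v i j h'

theorem exists_nf_eq (hm : D.IsAdmissible m) {w : FreeMonoid (Fin n)}
    (h : ∃ u v i j, IsRedex w u v i j) :
    ∃ u v i j, IsRedex w u v i j ∧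
      D.nf m (word R w) = D.nf m (word R u * D.rhs i j * word R v) := by
  have hr := h.choose_spec.choose_spec.choose_spec.choose_spec
  refine ⟨_, _, _, _, hr, ?_⟩
  rw [nf, extend_word, nfWord, WellFounded.fix_eq, nfStep, dif_pos h]
  refine map_eq_of_mem_supported _ _ (S := {z | wkey m z < wkey m w}) (fun z hz => ?_) ?_
  · rw [extend_word, extend_word, dif_pos (show wkey m z < wkey m w from hz)]
  · have := sandwich_rhs_mem hm hr.1 h.choose h.choose_spec.choose
    rwa [← hr.2] at this

theorem nf_toFree (q : StdPoly R n) : D.nf m (StdPoly.toFree R n q) = q := by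
  have : (D.nf m).comp (StdPoly.toFree R n) = LinearMap.id := by
    refine (MvPolynomial.basisMonomials (Fin n) R).ext fun α => ?_
    rw [MvPolynomial.coe_basisMonomials, LinearMap.comp_apply, toFree_monomial, one_smul,
      nf_of_not_redex (not_isRedex_stdWord α), wdeg_stdWord, LinearMap.id_apply]
  exact LinearMap.congr_fun this q

/-- The normal form respects all instances of the relations at words below `w`. -/
def NfInvariantBelow (D : CommRel R n) (m : MonomialOrder (Fin n)) (w : FreeMonoid (Fin n)) :
    Prop :=
  ∀ a b i j, i < j → wkey m (a * FreeMonoid.of j * FreeMonoid.of i * b) < wkey m w →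
    D.nf m (word R a * D.rel i j * word R b) = 0

theorem sandwich_rel (a b : FreeMonoid (Fin n)) (i j : Fin n) :
    word R a * D.rel i j * word R b = word R (a * FreeMonoid.of j * FreeMonoid.of i * b)
      - word R a * D.rhs i j * word R b := by
  simp only [rel, X, word_mul, mul_sub, sub_mul, mul_assoc]

/-- Write ρ, ρ' for the two relations and s, s' for their right hand sides. The two rewritings
differ by u(s t ρ' − ρ t s')v. Words of s and s' are smaller than the left hand sides they replace,
so all relations involved sit at words below `w`. -/
theorem nf_rhs_eq_of_disjoint (hm : D.IsAdmissible m) {w : FreeMonoid (Fin n)}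
    (hw : D.NfInvariantBelow m w) {u v t : FreeMonoid (Fin n)} {i j i' j' : Fin n}
    (hij : i < j) (hij' : i' < j')
    (h : w = u * FreeMonoid.of j * FreeMonoid.of i * t * FreeMonoid.of j' * FreeMonoid.of i' * v) :
    D.nf m (word R u * D.rhs i j * word R (t * FreeMonoid.of j' * FreeMonoid.of i' * v)) =
      D.nf m (word R (u * FreeMonoid.of j * FreeMonoid.of i * t) * D.rhs i' j' * word R v) := by
  have h1 : D.nf m (word R u * D.rhs i j * word R 1 * (word R t * D.rel i' j' * word R v)) = 0 := by
    have := map_mem_of_mem_supported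
      ((D.nf m).comp (LinearMap.mulLeftRight R (word R u, word R t * D.rel i' j' * word R v))) ⊥
      (S := {z | wkey m z < wkey m (FreeMonoid.of j * FreeMonoid.of i)}) (fun z hz => ?_)
      (rhs_mem hm hij)
    · simpa [word_one, mul_assoc] using this
    · rw [LinearMap.comp_apply, LinearMap.mulLeftRight_apply, Submodule.mem_bot]
      have e : word R u * word R z * (word R t * D.rel i' j' * word R v)
          = word R (u * z * t) * D.rel i' j' * word R v := by
        simp only [word_mul, mul_assoc]
      rw [e]
      refine hw _ _ _ _ hij' ?_
      rw [h]
      simpa only [mul_assoc] using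
        wkey_mul_lt hz u (t * FreeMonoid.of j' * FreeMonoid.of i' * v)
  have h2 : D.nf m ((word R u * D.rel i j * word R t) * D.rhs i' j' * word R v) = 0 := by
    have := map_mem_of_mem_supported
      ((D.nf m).comp (LinearMap.mulLeftRight R (word R u * D.rel i j * word R t, word R v))) ⊥
      (S := {z | wkey m z < wkey m (FreeMonoid.of j' * FreeMonoid.of i')}) (fun z hz => ?_)
      (rhs_mem hm hij')
    · simpa [word_one, mul_assoc] using this
    · rw [LinearMap.comp_apply, LinearMap.mulLeftRight_apply, Submodule.mem_bot]
      have e : word R u * D.rel i j * word R t * word R z * word R v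
          = word R u * D.rel i j * word R (t * z * v) := by
        simp only [word_mul, mul_assoc]
      rw [e]
      refine hw _ _ _ _ hij ?_
      rw [h]
      simpa only [mul_assoc] using
        wkey_mul_lt hz (u * FreeMonoid.of j * FreeMonoid.of i * t) v
  rw [← sub_eq_zero, ← map_sub]
  have e : word R u * D.rhs i j * word R (t * FreeMonoid.of j' * FreeMonoid.of i' * v)
      - word R (u * FreeMonoid.of j * FreeMonoid.of i * t) * D.rhs i' j' * word R v
      = word R u * D.rhs i j * word R 1 * (word R t * D.rel i' j' * word R v)
        - (word R u * D.rel i j * word R t) * D.rhs i' j' * word R v := by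
    simp only [rel, X, word_mul, word_one, mul_sub, sub_mul, mul_assoc, mul_one]
    abel
  rw [e, map_sub, h1, h2, sub_zero]

theorem X_mul_dFree_mem (hm : D.IsAdmissible m) {i j : Fin n} (h : i < j) (l : Fin n)
    (w : FreeMonoid (Fin n))
    (hw : wdeg w = Finsupp.single i 1 + Finsupp.single j 1 + Finsupp.single l 1) :
    X R l * D.dFree i j ∈ MonoidAlgebra.supported R R {z | wkey m z < wkey m w} := by
  have := sandwich_dFree_mem hm h (FreeMonoid.of l) 1 w (by rw [hw]; simp [add_comm])
  simpa only [X, word_one, mul_one] using this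

theorem dFree_mul_X_mem (hm : D.IsAdmissible m) {i j : Fin n} (h : i < j) (l : Fin n)
    (w : FreeMonoid (Fin n))
    (hw : wdeg w = Finsupp.single i 1 + Finsupp.single j 1 + Finsupp.single l 1) :
    D.dFree i j * X R l ∈ MonoidAlgebra.supported R R {z | wkey m z < wkey m w} := by
  have := sandwich_dFree_mem hm h 1 (FreeMonoid.of l) w (by rw [hw]; simp)
  simpa only [X, word_one, one_mul] using this

theorem nondeg_mem (hm : D.IsAdmissible m) {i j k : Fin n} (hij : i < j) (hjk : j < k) :
    D.nondeg i j k ∈ MonoidAlgebra.supported R R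
      {z | wkey m z < wkey m (FreeMonoid.of k * FreeMonoid.of j * FreeMonoid.of i)} := by
  unfold nondeg
  refine Submodule.sub_mem _ (Submodule.add_mem _ (Submodule.sub_mem _ (Submodule.add_mem _
    (Submodule.sub_mem _ (Submodule.smul_mem _ _ ?_) ?_) (Submodule.smul_mem _ _ ?_))
    (Submodule.smul_mem _ _ ?_)) ?_) (Submodule.smul_mem _ _ ?_)
  · exact dFree_mul_X_mem hm hij k _ (by simp only [wdeg_mul, wdeg_of]; abel)
  · exact X_mul_dFree_mem hm hij k _ (by simp only [wdeg_mul, wdeg_of]; abel)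
  · exact X_mul_dFree_mem hm (hij.trans hjk) j _ (by simp only [wdeg_mul, wdeg_of]; abel)
  · exact dFree_mul_X_mem hm (hij.trans hjk) j _ (by simp only [wdeg_mul, wdeg_of]; abel)
  · exact dFree_mul_X_mem hm hjk i _ (by simp only [wdeg_mul, wdeg_of]; abel)
  · exact X_mul_dFree_mem hm hjk i _ (by simp only [wdeg_mul, wdeg_of]; abel)

/-- A reduction step subtracts a multiple of a relation. Starting below `t`, the reduction stays
below `t`, so after multiplication by `u` and `v` every subtracted relation is killed by `nf`. -/
theorem nf_sandwich_eq_zero_of_reducesToZero (hm : D.IsAdmissible m)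
    {u t v : FreeMonoid (Fin n)} (hw : D.NfInvariantBelow m (u * t * v)) {f : Free R n}
    (hf : f ∈ MonoidAlgebra.supported R R {z | wkey m z < wkey m t}) (h : D.ReducesToZero f) :
    D.nf m (word R u * f * word R v) = 0 := by
  unfold ReducesToZero at h
  induction h using Relation.ReflTransGen.head_induction_on with
  | refl => simp
  | @head f g hs _ ih =>
    obtain ⟨a, b, i, j, hij, hg⟩ := hs
    change g = f - f.coeff (a * FreeMonoid.of j * FreeMonoid.of i * b) •
      (word R a * D.rel i j * word R b) at hg
    -- A step at a word that does not occur in `f` changes nothing; this case is separate because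
    -- such a word need not be below `t`.
    by_cases h0 : f.coeff (a * FreeMonoid.of j * FreeMonoid.of i * b) = 0
    · rw [h0, zero_smul, sub_zero] at hg
      subst hg
      exact ih hf
    · have hlt : wkey m (a * FreeMonoid.of j * FreeMonoid.of i * b) < wkey m t :=
        MonoidAlgebra.mem_supported.1 hf (Finsupp.mem_support_iff.2 h0)
      have hrel : word R a * D.rel i j * word R b ∈
          MonoidAlgebra.supported R R {z | wkey m z < wkey m t} := by
        rw [sandwich_rel]
        exact Submodule.sub_mem _ (word_mem_supported hlt) (MonoidAlgebra.supported_mono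
          (fun z hz => lt_trans hz hlt) (sandwich_rhs_mem hm hij a b))
      have hnf : D.nf m (word R (u * a) * D.rel i j * word R (b * v)) = 0 := by
        refine hw _ _ _ _ hij ?_
        simpa only [mul_assoc] using wkey_mul_lt hlt u v
      have hfg : f = g + f.coeff (a * FreeMonoid.of j * FreeMonoid.of i * b) •
          (word R a * D.rel i j * word R b) := by rw [hg, sub_add_cancel]
      have := ih (by rw [hg]; exact Submodule.sub_mem _ hf (Submodule.smul_mem _ _ hrel))
      rw [hfg, mul_add, add_mul, map_add, this, zero_add, mul_smul_comm, smul_mul_assoc, map_smul]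
      have e : word R u * (word R a * D.rel i j * word R b) * word R v
          = word R (u * a) * D.rel i j * word R (b * v) := by simp only [word_mul, mul_assoc]
      rw [e, hnf, smul_zero]

/-- The two rewritings of x_k x_j x_i differ by the nondegeneracy element plus multiples of
relations at further permutations of the three letters. -/
theorem rhs_mul_X_sub_X_mul_rhs (D : CommRel R n) (i j k : Fin n) :
    D.rhs j k * X R i - X R k * D.rhs i j = D.nondeg i j k
      + D.c j k • (X R j * D.rel i k) + (D.c j k * D.c i k) • (D.rel i j * X R k)
      - D.c i j • (D.rel i k * X R j) - (D.c i j * D.c i k) • (X R i * D.rel j k) := by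
  simp only [rel, rhs, nondeg, mul_add, add_mul, mul_sub, sub_mul, smul_add, smul_sub,
    mul_smul_comm, smul_mul_assoc, smul_smul, mul_assoc]
  module

theorem nf_rhs_eq_of_overlap (hm : D.IsAdmissible m) {w : FreeMonoid (Fin n)}
    (hw : D.NfInvariantBelow m w) {u v : FreeMonoid (Fin n)} {i j k : Fin n}
    (hij : i < j) (hjk : j < k) (hn : D.ReducesToZero (D.nondeg i j k))
    (h : w = u * FreeMonoid.of k * FreeMonoid.of j * FreeMonoid.of i * v) :
    D.nf m (word R u * D.rhs j k * word R (FreeMonoid.of i * v)) =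
      D.nf m (word R (u * FreeMonoid.of k) * D.rhs i j * word R v) := by
  have hik := hij.trans hjk
  have h0 : D.nf m (word R u * D.nondeg i j k * word R v) = 0 := by
    refine nf_sandwich_eq_zero_of_reducesToZero hm
      (t := FreeMonoid.of k * FreeMonoid.of j * FreeMonoid.of i) ?_ (nondeg_mem hm hij hjk) hn
    rw [h] at hw
    simpa only [mul_assoc] using hw
  -- The four remaining relations sit at permutations reached from x_k x_j x_i by sorting adjacent
  -- letters, hence at smaller words.
  have l1 : wkey m (FreeMonoid.of j * FreeMonoid.of k * FreeMonoid.of i) <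
      wkey m (FreeMonoid.of k * FreeMonoid.of j * FreeMonoid.of i) := by
    simpa using wkey_mul_lt (wkey_swap_lt (m := m) hjk) 1 (FreeMonoid.of i)
  have l2 : wkey m (FreeMonoid.of j * FreeMonoid.of i * FreeMonoid.of k) <
      wkey m (FreeMonoid.of k * FreeMonoid.of j * FreeMonoid.of i) := by
    refine lt_trans ?_ l1
    simpa [mul_assoc] using wkey_mul_lt (wkey_swap_lt (m := m) hik) (FreeMonoid.of j) 1
  have l3 : wkey m (FreeMonoid.of k * FreeMonoid.of i * FreeMonoid.of j) <
      wkey m (FreeMonoid.of k * FreeMonoid.of j * FreeMonoid.of i) := by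
    simpa [mul_assoc] using wkey_mul_lt (wkey_swap_lt (m := m) hij) (FreeMonoid.of k) 1
  have l4 : wkey m (FreeMonoid.of i * FreeMonoid.of k * FreeMonoid.of j) <
      wkey m (FreeMonoid.of k * FreeMonoid.of j * FreeMonoid.of i) := by
    refine lt_trans ?_ l3
    simpa [mul_assoc] using wkey_mul_lt (wkey_swap_lt (m := m) hik) 1 (FreeMonoid.of j)
  have h1 : D.nf m (word R u * (X R j * D.rel i k) * word R v) = 0 := by
    have := hw (u * FreeMonoid.of j) v i k hik
      (by rw [h]; simpa only [mul_assoc] using wkey_mul_lt l1 u v)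
    simpa only [X, word_mul, mul_assoc] using this
  have h2 : D.nf m (word R u * (D.rel i j * X R k) * word R v) = 0 := by
    have := hw u (FreeMonoid.of k * v) i j hij
      (by rw [h]; simpa only [mul_assoc] using wkey_mul_lt l2 u v)
    simpa only [X, word_mul, mul_assoc] using this
  have h3 : D.nf m (word R u * (D.rel i k * X R j) * word R v) = 0 := by
    have := hw u (FreeMonoid.of j * v) i k hik
      (by rw [h]; simpa only [mul_assoc] using wkey_mul_lt l3 u v)
    simpa only [X, word_mul, mul_assoc] using this
  have h4 : D.nf m (word R u * (X R i * D.rel j k) * word R v) = 0 := by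
    have := hw (u * FreeMonoid.of i) v j k hjk
      (by rw [h]; simpa only [mul_assoc] using wkey_mul_lt l4 u v)
    simpa only [X, word_mul, mul_assoc] using this
  have key := congrArg (fun f => D.nf m (word R u * f * word R v))
    (rhs_mul_X_sub_X_mul_rhs D i j k)
  simp only [mul_add, mul_sub, add_mul, sub_mul, map_add, map_sub, mul_smul_comm, smul_mul_assoc,
    map_smul] at key
  simp only [h0, h1, h2, h3, h4, smul_zero, add_zero, sub_zero] at key
  rw [sub_eq_zero] at key
  simpa only [X, word_mul, mul_assoc] using key

/-- Two redexes of the same word, the first one not to the right of the second one. -/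
theorem nf_rhs_eq_of_left (hm : D.IsAdmissible m)
    (hn : ∀ i j k : Fin n, i < j → j < k → D.ReducesToZero (D.nondeg i j k))
    {w : FreeMonoid (Fin n)} (hw : D.NfInvariantBelow m w) {u t v u' v' : FreeMonoid (Fin n)}
    {i j i' j' : Fin n} (h : IsRedex w u v i j) (h' : IsRedex w u' v' i' j') (hu : u' = u * t) :
    D.nf m (word R u * D.rhs i j * word R v) = D.nf m (word R u' * D.rhs i' j' * word R v') := by
  obtain ⟨hij, e⟩ := h
  obtain ⟨hij', e'⟩ := h'
  subst hu
  have e2 : FreeMonoid.of j * FreeMonoid.of i * v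
      = t * FreeMonoid.of j' * FreeMonoid.of i' * v' := by
    rw [e] at e'
    simpa only [mul_assoc, mul_right_inj] using e'
  have e3 := congrArg FreeMonoid.toList e2
  simp only [FreeMonoid.toList_mul, FreeMonoid.toList_of, List.append_assoc,
    List.cons_append, List.nil_append] at e3
  -- The length of `t` is the offset between the redexes: offset 0 means the same redex, 1 an
  -- overlap in one letter, at least 2 disjoint redexes.
  rcases ht : t.toList with _ | ⟨a, _ | ⟨b, l⟩⟩
  · have ht' : t = 1 := FreeMonoid.toList.injective ht
    simp only [ht, List.nil_append, List.cons.injEq, EmbeddingLike.apply_eq_iff_eq] at e3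
    obtain ⟨rfl, rfl, rfl⟩ := e3
    rw [ht', mul_one]
  · have ht' : t = FreeMonoid.of a := FreeMonoid.toList.injective ht
    simp only [ht, List.cons_append, List.nil_append, List.cons.injEq] at e3
    obtain ⟨rfl, rfl, e3⟩ := e3
    have hv : v = FreeMonoid.of i' * v' := FreeMonoid.toList.injective e3
    subst hv
    rw [ht']
    exact nf_rhs_eq_of_overlap hm hw hij' hij (hn _ _ _ hij' hij) (by rw [e]; simp only [mul_assoc])
  · have ht' : t = FreeMonoid.of a * FreeMonoid.of b * FreeMonoid.ofList l :=
      FreeMonoid.toList.injective ht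
    simp only [ht, List.cons_append, List.cons.injEq] at e3
    obtain ⟨rfl, rfl, e3⟩ := e3
    have hv : v = FreeMonoid.ofList l * FreeMonoid.of j' * FreeMonoid.of i' * v' := by
      apply FreeMonoid.toList.injective
      simpa [FreeMonoid.toList_mul] using e3
    subst hv
    rw [ht']
    have := nf_rhs_eq_of_disjoint hm hw (u := u) (v := v') (t := FreeMonoid.ofList l) hij hij'
      (by rw [e]; simp only [mul_assoc])
    simpa only [mul_assoc] using this

/-- The normal form does not depend on the chosen redex. Induction on the word order turns the claim
for smaller words into `NfInvariantBelow`, which is what resolving the ambiguities at `w` needs. -/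
theorem nf_word_eq (hm : D.IsAdmissible m)
    (hn : ∀ i j k : Fin n, i < j → j < k → D.ReducesToZero (D.nondeg i j k))
    (w : FreeMonoid (Fin n)) :
    ∀ u v i j, IsRedex w u v i j → D.nf m (word R w) = D.nf m (word R u * D.rhs i j * word R v) := by
  induction w using (wkey_wf m).induction with
  | _ w ih =>
  intro u v i j h
  have hw : D.NfInvariantBelow m w := by
    intro a b i j hij hlt
    rw [sandwich_rel, map_sub, sub_eq_zero]
    exact ih _ hlt _ _ _ _ ⟨hij, rfl⟩
  obtain ⟨u', v', i', j', h', e⟩ := exists_nf_eq hm ⟨u, v, i, j, h⟩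
  rw [e]
  have e2 := congrArg FreeMonoid.toList (h.2.symm.trans h'.2)
  simp only [mul_assoc] at e2
  -- Both `u` and `u'` are prefixes of `w`, so one of them extends the other.
  rw [FreeMonoid.toList_mul u, FreeMonoid.toList_mul u', List.append_eq_append_iff] at e2
  rcases e2 with ⟨t, ht, -⟩ | ⟨t, ht, -⟩
  · exact (nf_rhs_eq_of_left hm hn hw (t := FreeMonoid.ofList t) h h'
      (FreeMonoid.toList.injective ht)).symm
  · exact nf_rhs_eq_of_left hm hn hw (t := FreeMonoid.ofList t) h' h
      (FreeMonoid.toList.injective ht)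

theorem nf_sandwich_rel (hm : D.IsAdmissible m)
    (hn : ∀ i j k : Fin n, i < j → j < k → D.ReducesToZero (D.nondeg i j k))
    {i j : Fin n} (hij : i < j) (f g : Free R n) : D.nf m (f * D.rel i j * g) = 0 := by
  have hword : ∀ a b : FreeMonoid (Fin n), D.nf m (word R a * D.rel i j * word R b) = 0 := by
    intro a b
    rw [sandwich_rel, map_sub, sub_eq_zero]
    exact nf_word_eq hm hn _ _ _ _ _ ⟨hij, rfl⟩
  have top : ∀ f : Free R n, f ∈ MonoidAlgebra.supported R R Set.univ := fun f =>
    MonoidAlgebra.mem_supported.2 (Set.subset_univ _)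
  have h1 : ∀ (b : FreeMonoid (Fin n)) (f : Free R n),
      D.nf m (f * D.rel i j * word R b) = 0 := by
    intro b f
    have := map_mem_of_mem_supported
      ((D.nf m).comp (LinearMap.mulRight R (D.rel i j * word R b))) ⊥
      (fun z _ => by simpa [mul_assoc] using hword z b) (top f)
    simpa [mul_assoc] using this
  have := map_mem_of_mem_supported ((D.nf m).comp (LinearMap.mulLeft R (f * D.rel i j))) ⊥
      (fun z _ => by simpa [mul_assoc] using h1 z f) (top g)
  simpa [mul_assoc] using this

theorem nf_eq_of_mk_eq (hm : D.IsAdmissible m)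
    (hn : ∀ i j k : Fin n, i < j → j < k → D.ReducesToZero (D.nondeg i j k)) {f g : Free R n}
    (h : RingQuot.mkAlgHom R D.Rel f = RingQuot.mkAlgHom R D.Rel g) : D.nf m f = D.nf m g := by
  -- Quantifying over the two-sided factors makes closure of the relation under multiplication
  -- immediate.
  have key : ∀ f g, RingQuot.Rel D.Rel f g → ∀ a b, D.nf m (a * f * b) = D.nf m (a * g * b) := by
    intro f g hfg
    induction hfg with
    | of h =>
      obtain ⟨i, j, hij⟩ := h
      intro a b
      rw [← sub_eq_zero, ← map_sub, ← sub_mul, ← mul_sub]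
      exact nf_sandwich_rel hm hn hij a b
    | add_left _ ih => intro a b; simp only [mul_add, add_mul, map_add, ih]
    | @mul_left x y c _ ih =>
      intro a b
      simpa only [mul_assoc] using ih a (c * b)
    | @mul_right c x y _ ih =>
      intro a b
      simpa only [mul_assoc] using ih (a * c) b
  have e : Relation.EqvGen (RingQuot.Rel D.Rel) f g := by
    have h' : RingQuot.mkRingHom D.Rel f = RingQuot.mkRingHom D.Rel g := by
      rw [← RingQuot.mkAlgHom_coe R]
      exact h
    rw [RingQuot.mkRingHom_def] at h'
    exact Quot.eqvGen_exact (congrArg RingQuot.toQuot h')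
  clear h
  induction e with
  | rel x y h => simpa using key x y h 1 1
  | refl x => rfl
  | symm x y _ ih => exact ih.symm
  | trans x y z _ _ ih1 ih2 => exact ih1.trans ih2

/-- Standard monomials are linearly independent in a `G`-algebra. -/
theorem std_injective (hm : D.IsAdmissible m)
    (hn : ∀ i j k : Fin n, i < j → j < k → D.ReducesToZero (D.nondeg i j k)) :
    Function.Injective D.std := by
  intro q q' h
  have := nf_eq_of_mk_eq hm hn (m := m) (f := StdPoly.toFree R n q) (g := StdPoly.toFree R n q') h
  rwa [nf_toFree, nf_toFree] at this

end CommRel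

/-! ### Standard polynomials with bounded exponents, and leading terms. -/

section Below

variable {R : Type} [CommRing R] {n : ℕ} {m : MonomialOrder (Fin n)}

/-- The standard polynomials all of whose exponents are smaller than `δ`. -/
def below (R : Type) [CommRing R] {n : ℕ} (m : MonomialOrder (Fin n)) (δ : Fin n →₀ ℕ) :
    Submodule R (StdPoly R n) :=
  MvPolynomial.restrictSupport R {α | α ≺[m] δ}

theorem mem_below {δ : Fin n →₀ ℕ} {q : StdPoly R n} :
    q ∈ below R m δ ↔ ∀ α ∈ q.support, α ≺[m] δ := Iff.rfl

theorem monomial_mem_below {α δ : Fin n →₀ ℕ} (h : α ≺[m] δ) (c : R) :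
    MvPolynomial.monomial α c ∈ below R m δ :=
  (MvPolynomial.monomial_mem_restrictSupport (R := R)).2 (Or.inl h)

theorem below_mono {δ ε : Fin n →₀ ℕ} (h : δ ≼[m] ε) : below R m δ ≤ below R m ε :=
  MvPolynomial.restrictSupport_mono R fun _ hα => lt_of_lt_of_le hα h

theorem coeff_eq_zero_of_mem_below {δ : Fin n →₀ ℕ} {q : StdPoly R n} (h : q ∈ below R m δ) :
    q.coeff δ = 0 := by
  by_contra h0
  exact lt_irrefl _ (mem_below.1 h δ (MvPolynomial.mem_support_iff.2 h0))

theorem coeff_monomial_add {α : Fin n →₀ ℕ} {q : StdPoly R n} (h : q ∈ below R m α) (c : R) :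
    (MvPolynomial.monomial α c + q).coeff α = c := by
  simp [coeff_eq_zero_of_mem_below h]

theorem degree_monomial_add {α : Fin n →₀ ℕ} {q : StdPoly R n} (h : q ∈ below R m α) {c : R}
    (hc : c ≠ 0) : m.degree (MvPolynomial.monomial α c + q) = α := by
  apply m.toSyn.injective
  apply le_antisymm
  · rw [m.degree_le_iff]
    intro β hβ
    by_cases hβα : β = α
    · rw [hβα]
    · refine (mem_below.1 h β ?_).le
      rw [MvPolynomial.mem_support_iff] at hβ ⊢
      simpa [MvPolynomial.coeff_monomial, Ne.symm hβα] using hβ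
  · apply m.le_degree
    rw [MvPolynomial.mem_support_iff, coeff_monomial_add h]
    exact hc

theorem monomial_add_ne_zero {α : Fin n →₀ ℕ} {q : StdPoly R n} (h : q ∈ below R m α) {c : R}
    (hc : c ≠ 0) : MvPolynomial.monomial α c + q ≠ 0 := by
  intro h0
  have := coeff_monomial_add h c
  rw [h0] at this
  exact hc (by simpa using this.symm)

theorem mem_below_of_le {δ : Fin n →₀ ℕ} {q : StdPoly R n} (h : ∀ α ∈ q.support, α ≼[m] δ)
    (h0 : q.coeff δ = 0) : q ∈ below R m δ := by
  rw [mem_below]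
  intro α hα
  refine lt_of_le_of_ne (h α hα) fun e => ?_
  rw [m.toSyn.injective e] at hα
  exact MvPolynomial.mem_support_iff.1 hα h0

theorem sub_monomial_mem_below (q : StdPoly R n) :
    q - MvPolynomial.monomial (m.degree q) (m.leadingCoeff q) ∈ below R m (m.degree q) := by
  apply mem_below_of_le
  · intro α hα
    by_cases hα' : α = m.degree q
    · rw [hα']
    · apply m.le_degree
      rw [MvPolynomial.mem_support_iff] at hα ⊢
      simpa [MvPolynomial.coeff_monomial, Ne.symm hα'] using hα
  · simp [MonomialOrder.leadingCoeff]

theorem exists_eq_monomial_add (q : StdPoly R n) :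
    ∃ r ∈ below R m (m.degree q),
      q = MvPolynomial.monomial (m.degree q) (m.leadingCoeff q) + r :=
  ⟨_, sub_monomial_mem_below q, by abel⟩

theorem map_mem_below {S : Type} [CommRing S] (φ : R →+* S) {δ : Fin n →₀ ℕ} {q : StdPoly R n}
    (h : q ∈ below R m δ) : MvPolynomial.map φ q ∈ below S m δ :=
  mem_below.2 fun α hα => mem_below.1 h α (MvPolynomial.support_map_subset φ q hα)

end Below

namespace CommRel

/-! ### Leading terms of products, and exponents of reduced Gröbner bases. -/

section LeadingTerms

variable {R : Type} [CommRing R] {n : ℕ} (D : CommRel R n) {m : MonomialOrder (Fin n)}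

/-- The multiplicative monoid that is generated by the coefficients `c_{ij}`, `i < j`. -/
def cMonoid : Submonoid R := Submonoid.closure {x | ∃ i j : Fin n, i < j ∧ x = D.c i j}

theorem std_monomial (α : Fin n →₀ ℕ) (c : R) :
    D.std (MvPolynomial.monomial α c) = c • RingQuot.mkAlgHom R D.Rel (word R (stdWord α)) := by
  rw [std, LinearMap.comp_apply, toFree_monomial, map_smul]
  rfl

variable {D}

theorem mk_X_mul_X {i j : Fin n} (h : i < j) :
    RingQuot.mkAlgHom R D.Rel (X R j * X R i) = RingQuot.mkAlgHom R D.Rel (D.rhs i j) :=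
  RingQuot.mkAlgHom_rel R (Rel.comm i j h)

/-- Sorting the word contributes a factor c_{ij} per swap, while the d_{ij} contribute only smaller
exponents. Recording that the leading coefficient is a product of c_{ij} is what later controls it
modulo p. -/
theorem exists_mk_word_eq (hm : D.IsAdmissible m) (w : FreeMonoid (Fin n)) :
    ∃ c ∈ D.cMonoid, ∃ r ∈ below R m (wdeg w), RingQuot.mkAlgHom R D.Rel (word R w) =
      D.std (MvPolynomial.monomial (wdeg w) c + r) := by
  induction w using (wkey_wf m).induction with
  | _ w ih =>
  by_cases hw : w.toList.Pairwise (· ≤ ·)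
  · refine ⟨1, one_mem _, 0, zero_mem _, ?_⟩
    rw [add_zero, std_monomial, one_smul, ← eq_stdWord_of_pairwise hw]
  · obtain ⟨u, v, i, j, hij, e⟩ := exists_isRedex hw
    have hlt : wkey m (u * (FreeMonoid.of i * FreeMonoid.of j) * v) < wkey m w := by
      rw [e]
      simpa only [mul_assoc] using wkey_mul_lt (wkey_swap_lt hij) u v
    obtain ⟨c, hc, r, hr, h⟩ := ih _ hlt
    have hd : wdeg (u * (FreeMonoid.of i * FreeMonoid.of j) * v) = wdeg w := by
      rw [e]; simp only [wdeg_mul]; abel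
    rw [hd] at hr h
    have h2 : RingQuot.mkAlgHom R D.Rel (word R u * D.dFree i j * word R v) ∈
        (below R m (wdeg w)).map D.std := by
      refine map_mem_of_mem_supported (RingQuot.mkAlgHom R D.Rel).toLinearMap _
        (S := {z | wdeg z ≺[m] wdeg w}) (fun z hz => ?_) ?_
      · obtain ⟨c, -, r, hr, h⟩ := ih z (wkey_lt_of_wdeg_lt hz)
        exact ⟨_, add_mem (monomial_mem_below hz c) (below_mono (le_of_lt hz) hr), h.symm⟩
      · refine sandwich_mem_supported u v (fun z hz => ?_) (dFree_mem hm hij)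
        rw [e]
        simp only [wdeg_mul, wdeg_of, map_add, Set.mem_ofPred_eq] at hz ⊢
        rw [add_assoc _ (m.toSyn (Finsupp.single j 1)), add_comm (m.toSyn (Finsupp.single j 1))]
        gcongr
    obtain ⟨s, hs, hs'⟩ := h2
    refine ⟨D.c i j * c, mul_mem (Submonoid.subset_closure ⟨i, j, hij, rfl⟩) hc,
      D.c i j • r + s, add_mem (Submodule.smul_mem _ _ hr) hs, ?_⟩
    have e1 : RingQuot.mkAlgHom R D.Rel (word R w)
        = RingQuot.mkAlgHom R D.Rel (word R u * D.rhs i j * word R v) := by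
      have : word R w = word R u * (X R j * X R i) * word R v := by
        rw [e]; simp only [X, word_mul, mul_assoc]
      rw [this, map_mul, map_mul, mk_X_mul_X hij, ← map_mul, ← map_mul]
    have e2 : word R u * D.rhs i j * word R v
        = D.c i j • word R (u * (FreeMonoid.of i * FreeMonoid.of j) * v)
          + word R u * D.dFree i j * word R v := by
      simp only [rhs, X, word_mul, mul_add, add_mul, mul_smul_comm, smul_mul_assoc, mul_assoc]
    rw [e1, e2, map_add, map_smul, h, ← hs', ← map_smul, ← map_add, smul_add,
      MvPolynomial.smul_monomial, smul_eq_mul, add_assoc]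

theorem std_surjective (hm : D.IsAdmissible m) : Function.Surjective D.std := by
  intro x
  obtain ⟨f, rfl⟩ := RingQuot.mkAlgHom_surjective R D.Rel x
  refine map_mem_of_mem_supported (RingQuot.mkAlgHom R D.Rel).toLinearMap (LinearMap.range D.std)
    (S := Set.univ) (fun z _ => ?_) (MonoidAlgebra.mem_supported.2 (Set.subset_univ _))
  obtain ⟨c, -, r, -, h⟩ := exists_mk_word_eq hm z
  exact ⟨_, h.symm⟩

theorem exists_std_monomial_mul (hm : D.IsAdmissible m) (γ α : Fin n →₀ ℕ) :
    ∃ c ∈ D.cMonoid, ∃ r ∈ below R m (γ + α),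
      D.std (MvPolynomial.monomial γ 1) * D.std (MvPolynomial.monomial α 1) =
        D.std (MvPolynomial.monomial (γ + α) c + r) := by
  have := exists_mk_word_eq hm (stdWord γ * stdWord α)
  rwa [wdeg_mul, wdeg_stdWord, wdeg_stdWord, word_mul, map_mul, ← one_smul R
    (RingQuot.mkAlgHom R D.Rel (word R (stdWord γ))), ← std_monomial, ← one_smul R
    (RingQuot.mkAlgHom R D.Rel (word R (stdWord α))), ← std_monomial] at this

/-- Multiplication of an element by a standard monomial, up to lower terms. -/
theorem exists_std_monomial_mul_std (hm : D.IsAdmissible m) (γ α : Fin n →₀ ℕ) (a : R)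
    {q : StdPoly R n} (hq : q ∈ below R m α) :
    ∃ c ∈ D.cMonoid, ∃ r ∈ below R m (γ + α),
      D.std (MvPolynomial.monomial γ 1) * D.std (MvPolynomial.monomial α a + q) =
        D.std (MvPolynomial.monomial (γ + α) (c * a) + r) := by
  obtain ⟨c, hc, r, hr, h⟩ := exists_std_monomial_mul hm γ α
  have h2 : D.std (MvPolynomial.monomial γ 1) * D.std q ∈ (below R m (γ + α)).map D.std := by
    refine map_mem_of_mem_restrictSupport
      ((LinearMap.mulLeft R (D.std (MvPolynomial.monomial γ 1))).comp D.std) _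
      (fun β hβ => ?_) hq
    obtain ⟨c, -, r, hr, h⟩ := exists_std_monomial_mul hm γ β
    have hlt : γ + β ≺[m] γ + α := by
      have : β ≺[m] α := hβ
      simp only [map_add]
      gcongr
    exact ⟨_, add_mem (monomial_mem_below hlt c) (below_mono hlt.le hr), h.symm⟩
  obtain ⟨s, hs, hs'⟩ := h2
  refine ⟨c, hc, a • r + s, add_mem (Submodule.smul_mem _ _ hr) hs, ?_⟩
  have e : MvPolynomial.monomial α a = a • MvPolynomial.monomial α (1 : R) := by
    rw [MvPolynomial.smul_monomial, smul_eq_mul, mul_one]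
  rw [e, map_add, mul_add, ← hs', map_smul, mul_smul_comm, h, ← map_smul, ← map_add, smul_add,
    MvPolynomial.smul_monomial, smul_eq_mul, mul_comm a c, add_assoc]

theorem mem_exps_singleton (hinj : Function.Injective D.std) {q : StdPoly R n} (hq : q ≠ 0)
    {β : Fin n →₀ ℕ} : β ∈ D.exps m {D.std q} ↔ β = m.degree q := by
  constructor
  · rintro ⟨f, rfl, -, q', hq', rfl⟩
    rw [hinj hq']
  · rintro rfl
    exact ⟨_, rfl, (map_ne_zero_iff _ hinj).2 hq, q, rfl, rfl⟩

/-- The exponents of a reduced Gröbner basis are the minimal exponents of the ideal. -/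
theorem exps_eq_of_isReducedGroebnerBasis (hinj : Function.Injective D.std) {I : Ideal D.Alg}
    {G : Set D.Alg} (hG : D.IsReducedGroebnerBasis m I G) :
    D.exps m G = {α | Minimal (· ∈ D.exps m (I : Set D.Alg)) α} := by
  have hE := hG.exps_eq
  have hsub : ∀ α ∈ D.exps m G, α ∈ D.exps m (I : Set D.Alg) := by
    intro α hα
    rw [hE]
    exact ⟨α, hα, 0, (add_zero α).symm⟩
  ext α
  constructor
  · intro hα
    refine ⟨hsub α hα, fun δ hδ hle => ?_⟩
    rw [hE] at hδ
    obtain ⟨β, hβ, γ, rfl⟩ := hδ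
    obtain ⟨g, hg, hg0, q, rfl, rfl⟩ := hα
    obtain ⟨h, hh, hh0, q', rfl, rfl⟩ := hβ
    by_cases hgh : D.std q' = D.std q
    · rw [hinj hgh]; exact le_self_add
    · exfalso
      -- Two different elements of the basis cannot have comparable leading exponents, since the
      -- leading exponent belongs to the Newton diagram.
      obtain ⟨q₁, hq₁, -, hred⟩ := hG.reduced _ hg
      rw [hinj hq₁] at hred
      have hq0 : q ≠ 0 := fun e => hg0 (by rw [e, map_zero])
      obtain ⟨ε, hε⟩ := exists_add_of_le (le_self_add.trans hle : m.degree q' ≤ m.degree q)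
      exact hred _ hh hgh _ (m.degree_mem_support hq0) _
        ⟨_, rfl, hh0, q', rfl, rfl⟩ ⟨ε, hε⟩
  · rintro ⟨hα, hmin⟩
    have hα' := hα
    rw [hE] at hα'
    obtain ⟨β, hβ, γ, rfl⟩ := hα'
    have := hmin (hsub β hβ) le_self_add
    rwa [le_antisymm this le_self_add]

end LeadingTerms

/-! ### Existence of reduced Gröbner bases over a field. -/

section Field

variable {K : Type} [Field K] {n : ℕ} {D : CommRel K n} {m : MonomialOrder (Fin n)}

theorem smul_mem_ideal (I : Ideal D.Alg) (a : K) {x : D.Alg} (hx : x ∈ I) : a • x ∈ I :=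
  Submodule.smul_of_tower_mem I a hx

theorem mem_exps_ideal_iff (hinj : Function.Injective D.std) {I : Ideal D.Alg}
    {α : Fin n →₀ ℕ} : α ∈ D.exps m (I : Set D.Alg) ↔
      ∃ q ∈ below K m α, D.std (MvPolynomial.monomial α 1 + q) ∈ I := by
  constructor
  · rintro ⟨f, hf, hf0, q, rfl, rfl⟩
    have hq0 : q ≠ 0 := fun e => hf0 (by rw [e, map_zero])
    have ha : m.leadingCoeff q ≠ 0 := m.leadingCoeff_ne_zero_iff.2 hq0
    obtain ⟨r, hr, e⟩ := exists_eq_monomial_add (m := m) q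
    refine ⟨(m.leadingCoeff q)⁻¹ • r, Submodule.smul_mem _ _ hr, ?_⟩
    have : MvPolynomial.monomial (m.degree q) 1 + (m.leadingCoeff q)⁻¹ • r
        = (m.leadingCoeff q)⁻¹ • q := by
      have e' := congrArg ((m.leadingCoeff q)⁻¹ • ·) e
      simp only [smul_add, MvPolynomial.smul_monomial, smul_eq_mul, inv_mul_cancel₀ ha] at e'
      exact e'.symm
    rw [this, map_smul]
    exact smul_mem_ideal I _ hf
  · rintro ⟨q, hq, h⟩
    exact ⟨_, h, (map_ne_zero_iff _ hinj).2 (monomial_add_ne_zero hq one_ne_zero), _, rfl,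
      degree_monomial_add hq one_ne_zero⟩

theorem cMonoid_ne_zero (hc : ∀ i j : Fin n, i < j → D.c i j ≠ 0) {c : K} (h : c ∈ D.cMonoid) :
    c ≠ 0 := by
  induction h using Submonoid.closure_induction with
  | mem x hx => obtain ⟨i, j, hij, rfl⟩ := hx; exact hc i j hij
  | one => exact one_ne_zero
  | mul x y _ _ hx hy => exact mul_ne_zero hx hy

theorem add_mem_exps_ideal (hm : D.IsAdmissible m) (hinj : Function.Injective D.std)
    (hc : ∀ i j : Fin n, i < j → D.c i j ≠ 0) {I : Ideal D.Alg} {α : Fin n →₀ ℕ}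
    (hα : α ∈ D.exps m (I : Set D.Alg)) (γ : Fin n →₀ ℕ) :
    γ + α ∈ D.exps m (I : Set D.Alg) := by
  obtain ⟨q, hq, h⟩ := (mem_exps_ideal_iff hinj).1 hα
  obtain ⟨c, hcm, r, hr, e⟩ := exists_std_monomial_mul_std hm γ α 1 hq
  have hc0 : c * 1 ≠ 0 := by rw [mul_one]; exact cMonoid_ne_zero hc hcm
  exact ⟨_, I.mul_mem_left _ h, by
    rw [e]; exact (map_ne_zero_iff _ hinj).2 (monomial_add_ne_zero hr hc0), _, e.symm,
    degree_monomial_add hr hc0⟩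

/-- Division with remainder, by well-founded induction: a monomial with exponent in exp(I) is
congruent modulo `I` to a combination of smaller ones. -/
theorem monomial_mem_sup_ideal (hinj : Function.Injective D.std) (I : Ideal D.Alg)
    (α : Fin n →₀ ℕ) : MvPolynomial.monomial α (1 : K) ∈
      MvPolynomial.restrictSupport K {β | β ≼[m] α ∧ β ∉ D.exps m (I : Set D.Alg)} ⊔
        (I.restrictScalars K).comap D.std := by
  induction α using (InvImage.wf m.toSyn wellFounded_lt).induction with
  | _ α ih =>
  by_cases hα : α ∈ D.exps m (I : Set D.Alg)
  · obtain ⟨q, hq, h⟩ := (mem_exps_ideal_iff hinj).1 hα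
    have hq' : q ∈ MvPolynomial.restrictSupport K
        {β | β ≼[m] α ∧ β ∉ D.exps m (I : Set D.Alg)} ⊔ (I.restrictScalars K).comap D.std := by
      refine map_mem_of_mem_restrictSupport LinearMap.id _ (fun β hβ => ?_) hq
      refine sup_le_sup_right (MvPolynomial.restrictSupport_mono K fun δ hδ => ?_) _ (ih β hβ)
      exact ⟨hδ.1.trans (le_of_lt hβ), hδ.2⟩
    have := Submodule.sub_mem _ (Submodule.mem_sup_right (S := MvPolynomial.restrictSupport K
        {β | β ≼[m] α ∧ β ∉ D.exps m (I : Set D.Alg)})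
        (show MvPolynomial.monomial α (1 : K) + q ∈ (I.restrictScalars K).comap D.std from h)) hq'
    rwa [add_sub_cancel_right] at this
  · exact Submodule.mem_sup_left
      ((MvPolynomial.monomial_mem_restrictSupport (R := K)).2 (Or.inl ⟨le_rfl, hα⟩))

theorem exists_reduced_of_mem_exps (hinj : Function.Injective D.std) {I : Ideal D.Alg}
    {α : Fin n →₀ ℕ} (hα : α ∈ D.exps m (I : Set D.Alg)) :
    ∃ q ∈ below K m α, (∀ β ∈ q.support, β ∉ D.exps m (I : Set D.Alg)) ∧
      D.std (MvPolynomial.monomial α 1 + q) ∈ I := by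
  obtain ⟨q, hq, h⟩ := (mem_exps_ideal_iff hinj).1 hα
  have hq' : q ∈ MvPolynomial.restrictSupport K
      {β | β ≺[m] α ∧ β ∉ D.exps m (I : Set D.Alg)} ⊔ (I.restrictScalars K).comap D.std := by
    refine map_mem_of_mem_restrictSupport LinearMap.id _ (fun β hβ => ?_) hq
    refine sup_le_sup_right (MvPolynomial.restrictSupport_mono K fun δ hδ => ?_) _
      (monomial_mem_sup_ideal (m := m) hinj I β)
    exact ⟨lt_of_le_of_lt hδ.1 hβ, hδ.2⟩
  obtain ⟨r, hr, s, hs, rfl⟩ := Submodule.mem_sup.1 hq'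
  refine ⟨r, fun β hβ => (hr hβ).1, fun β hβ => (hr hβ).2, ?_⟩
  have := I.sub_mem h (show D.std s ∈ I from hs)
  rwa [← map_sub, ← add_assoc, add_sub_cancel_right] at this

/-- Take one monic element with reduced tail for each minimal exponent of `I`. -/
theorem exists_isReducedGroebnerBasis (hm : D.IsAdmissible m)
    (hinj : Function.Injective D.std) (hc : ∀ i j : Fin n, i < j → D.c i j ≠ 0)
    (I : Ideal D.Alg) : ∃ G : Set D.Alg, D.IsReducedGroebnerBasis m I G := by
  set E := D.exps m (I : Set D.Alg) with hE
  have hex : ∀ α : {α | Minimal (· ∈ E) α}, ∃ q ∈ below K m α.1, (∀ β ∈ q.support, β ∉ E) ∧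
      D.std (MvPolynomial.monomial α.1 1 + q) ∈ I :=
    fun α => exists_reduced_of_mem_exps hinj α.2.prop
  choose q hq hqE hqI using hex
  -- Dickson's lemma: antichains in ℕⁿ are finite.
  have hfin : {α | Minimal (· ∈ E) α}.Finite :=
    WellQuasiOrderedLE.finite_of_isAntichain (setOfPred_minimal_antichain _)
  have hdeg : ∀ α, m.degree (MvPolynomial.monomial α.1 1 + q α) = α.1 := fun α =>
    degree_monomial_add (hq α) one_ne_zero
  have hne : ∀ α, MvPolynomial.monomial α.1 1 + q α ≠ 0 := fun α =>
    monomial_add_ne_zero (hq α) one_ne_zero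
  refine ⟨Set.range fun α => D.std (MvPolynomial.monomial α.1 1 + q α),
    ⟨have := hfin.to_subtype; Set.finite_range _, ?_, ?_⟩, ?_⟩
  · rintro _ ⟨α, rfl⟩
    exact ⟨hqI α, (map_ne_zero_iff _ hinj).2 (hne α)⟩
  · ext α
    constructor
    · intro hα
      obtain ⟨β, hβα, hβ⟩ := exists_minimal_le_of_wellFoundedLT (· ∈ E) α hα
      obtain ⟨γ, hγ⟩ := exists_add_of_le hβα
      exact ⟨β, ⟨_, ⟨⟨β, hβ⟩, rfl⟩, (map_ne_zero_iff _ hinj).2 (hne _), _, rfl, hdeg ⟨β, hβ⟩⟩, γ, hγ⟩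
    · rintro ⟨_, ⟨_, ⟨β, rfl⟩, -, q', hq', rfl⟩, γ, rfl⟩
      rw [hinj hq', hdeg, add_comm]
      exact add_mem_exps_ideal hm hinj hc β.2.prop γ
  · rintro _ ⟨α, rfl⟩
    refine ⟨_, rfl, ?_, ?_⟩
    · rw [MonomialOrder.leadingCoeff, hdeg, coeff_monomial_add (hq α)]
    · rintro _ ⟨β, rfl⟩ hne' δ hδ ε hε ⟨γ, rfl⟩
      rw [mem_exps_singleton hinj (hne β), hdeg] at hε
      subst hε
      have hmem : β.1 + γ ∈ E := by
        rw [add_comm]; exact add_mem_exps_ideal hm hinj hc β.2.prop γ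
      -- A leading exponent divisible by `β` equals `β` by minimality; a tail exponent avoids `E` by
      -- construction.
      by_cases hα : β.1 + γ = α.1
      · have : α.1 ≤ β.1 := α.2.2 β.2.prop (by rw [← hα]; exact le_self_add)
        have h2 : β.1 ≤ α.1 := by rw [← hα]; exact le_self_add
        exact hne' (by rw [Subtype.ext (le_antisymm h2 this)])
      · refine hqE α _ ?_ hmem
        rw [MvPolynomial.mem_support_iff] at hδ ⊢
        simpa [MvPolynomial.coeff_monomial, Ne.symm hα] using hδ

end Field

end CommRel

/-! ### Change of coefficients. -/

section BaseChange

variable {R S : Type} [CommRing R] [CommRing S] {n : ℕ} (φ : R →+* S)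

/-- Apply a ring homomorphism to all coefficients of an element of the free algebra. -/
abbrev mapFree : Free R n →+* Free S n := MonoidAlgebra.mapRingHom (FreeMonoid (Fin n)) φ

@[simp] theorem mapFree_word (w : FreeMonoid (Fin n)) : mapFree φ (word R w) = word S w := by
  simp [word, mapFree, MonoidAlgebra.mapRingHom_single]

@[simp] theorem mapFree_smul (a : R) (f : Free R n) :
    mapFree φ (a • f) = φ a • mapFree φ f := by
  ext w
  simp

@[simp] theorem mapFree_X (i : Fin n) : mapFree φ (X R i) = X S i := mapFree_word φ _

@[simp] theorem mapFree_toFree (q : StdPoly R n) :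
    mapFree φ (StdPoly.toFree R n q) = StdPoly.toFree S n (MvPolynomial.map φ q) := by
  induction q using MvPolynomial.induction_on' with
  | monomial α a =>
    rw [MvPolynomial.map_monomial, toFree_monomial, toFree_monomial, mapFree_smul, mapFree_word]
  | add p q hp hq => rw [map_add, map_add, map_add, map_add, hp, hq]

theorem mapFree_injective (hφ : Function.Injective φ) :
    Function.Injective (mapFree (n := n) φ) := by
  intro f g h
  ext w
  have := congrArg (fun x : Free S n => x.coeff w) h
  exact hφ (by simpa using this)

namespace CommRel

variable (D : CommRel R n)

@[simp] theorem mapFree_dFree (i j : Fin n) :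
    mapFree φ (D.dFree i j) = (D.map φ).dFree i j := mapFree_toFree φ _

@[simp] theorem mapFree_rhs (i j : Fin n) : mapFree φ (D.rhs i j) = (D.map φ).rhs i j := by
  simp only [rhs, map_add, mapFree_smul, map_mul, mapFree_X, mapFree_dFree]
  rfl

@[simp] theorem mapFree_rel (i j : Fin n) : mapFree φ (D.rel i j) = (D.map φ).rel i j := by
  simp only [rel, map_sub, map_mul, mapFree_X, mapFree_rhs]

theorem mapFree_nondeg (i j k : Fin n) :
    mapFree φ (D.nondeg i j k) = (D.map φ).nondeg i j k := by
  simp only [nondeg, map_add, map_sub, mapFree_smul, map_mul, mapFree_X, mapFree_dFree]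
  rfl

theorem mapFree_step (f : Free R n) (u v : FreeMonoid (Fin n)) (i j : Fin n) :
    mapFree φ (f - f.coeff (u * FreeMonoid.of j * FreeMonoid.of i * v) •
        (word R u * D.rel i j * word R v)) =
      mapFree φ f - (mapFree φ f).coeff (u * FreeMonoid.of j * FreeMonoid.of i * v) •
        (word S u * (D.map φ).rel i j * word S v) := by
  have e : mapFree φ (word R u * D.rel i j * word R v)
      = word S u * (D.map φ).rel i j * word S v := by
    rw [map_mul, map_mul, mapFree_word, mapFree_word, mapFree_rel]
  rw [map_sub, mapFree_smul, e, MonoidAlgebra.coeff_mapRingHom]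

/-- A step whose coefficient is killed by `φ` becomes a trivial step, which `Step` allows; so no
injectivity is needed. -/
theorem reducesToZero_map {f : Free R n} (h : D.ReducesToZero f) :
    (D.map φ).ReducesToZero (mapFree φ f) := by
  unfold ReducesToZero at h
  induction h using Relation.ReflTransGen.head_induction_on with
  | refl => rw [map_zero]; exact Relation.ReflTransGen.refl
  | head hs _ ih =>
    obtain ⟨u, v, i, j, hij, rfl⟩ := hs
    exact Relation.ReflTransGen.head ⟨u, v, i, j, hij, mapFree_step φ D _ u v i j⟩ ih

/-- A step is determined by its starting element and its position, and involves no division, so the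
whole reduction is already defined over `R`. -/
theorem reducesToZero_of_map (hφ : Function.Injective φ) {f : Free R n}
    (h : (D.map φ).ReducesToZero (mapFree φ f)) : D.ReducesToZero f := by
  unfold ReducesToZero at h
  generalize hg : mapFree φ f = g at h
  induction h using Relation.ReflTransGen.head_induction_on generalizing f with
  | refl =>
    rw [mapFree_injective φ hφ (hg.trans (map_zero _).symm)]
    exact Relation.ReflTransGen.refl
  | head hs _ ih =>
    obtain ⟨u, v, i, j, hij, rfl⟩ := hs
    subst hg
    exact Relation.ReflTransGen.head ⟨u, v, i, j, hij, rfl⟩ (ih (mapFree_step φ D f u v i j))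

theorem isAdmissible_map {m : MonomialOrder (Fin n)} (hm : D.IsAdmissible m) :
    (D.map φ).IsAdmissible m := by
  intro i j hij
  by_cases h : MvPolynomial.map φ (D.d i j) = 0
  · exact Or.inl h
  · right
    exact map_mem_below φ (d_mem hm hij) (m.degree_mem_support h)

theorem isAdmissible_of_map (hφ : Function.Injective φ) {m : MonomialOrder (Fin n)}
    (hm : (D.map φ).IsAdmissible m) : D.IsAdmissible m := by
  intro i j hij
  by_cases h : D.d i j = 0
  · exact Or.inl h
  · right
    refine d_mem hm hij ?_
    change m.degree (D.d i j) ∈ (MvPolynomial.map φ (D.d i j)).support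
    rw [MvPolynomial.support_map_of_injective _ hφ]
    exact m.degree_mem_support h

/-- The change of coefficients on the algebras that are defined by commutation relations. -/
def mapAlg : D.Alg →+* (D.map φ).Alg :=
  RingQuot.lift ⟨(RingQuot.mkRingHom (D.map φ).Rel).comp (mapFree φ), by
    rintro _ _ ⟨i, j, hij⟩
    have := RingQuot.mkRingHom_rel (Rel.comm (D := D.map φ) i j hij)
    change RingQuot.mkRingHom _ (mapFree φ _) = RingQuot.mkRingHom _ (mapFree φ (D.rhs i j))
    rw [mapFree_rhs, map_mul, mapFree_X, mapFree_X]
    exact this⟩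

theorem mapAlg_std (q : StdPoly R n) :
    D.mapAlg φ (D.std q) = (D.map φ).std (MvPolynomial.map φ q) := by
  have e : ∀ (R : Type) [CommRing R] (D : CommRel R n) (q : StdPoly R n),
      D.std q = RingQuot.mkRingHom D.Rel (StdPoly.toFree R n q) := by
    intro R _ D q
    rw [← RingQuot.mkAlgHom_coe R]
    rfl
  rw [e, e, mapAlg, RingQuot.lift_mkRingHom_apply, RingHom.comp_apply, mapFree_toFree]

theorem mapAlg_surjective (hφ : Function.Surjective φ) {m : MonomialOrder (Fin n)}
    (hm : D.IsAdmissible m) : Function.Surjective (D.mapAlg φ) := by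
  intro y
  obtain ⟨q, rfl⟩ := std_surjective (isAdmissible_map φ D hm) y
  obtain ⟨q', rfl⟩ := MvPolynomial.map_surjective φ hφ q
  exact ⟨D.std q', mapAlg_std φ D q'⟩

end CommRel

end BaseChange

/-! ### Integral structure: clearing denominators. -/

namespace CommRel

section Integral

variable {n : ℕ} (D : CommRel ℤ n) {m : MonomialOrder (Fin n)}

theorem exists_smul_eq_map_intCast (q : StdPoly ℚ n) :
    ∃ N : ℤ, N ≠ 0 ∧ ∃ q' : StdPoly ℤ n,
      (N : ℚ) • q = MvPolynomial.map (Int.castRingHom ℚ) q' := by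
  induction q using MvPolynomial.induction_on' with
  | monomial α a =>
    refine ⟨a.den, by exact_mod_cast a.den_ne_zero, MvPolynomial.monomial α a.num, ?_⟩
    rw [MvPolynomial.map_monomial, MvPolynomial.smul_monomial]
    congr 1
    simp [mul_comm]
  | add p q hp hq =>
    obtain ⟨N, hN, p', hp⟩ := hp
    obtain ⟨M, hM, q', hq⟩ := hq
    refine ⟨N * M, mul_ne_zero hN hM, M • p' + N • q', ?_⟩
    rw [map_add, map_zsmul, map_zsmul, ← hp, ← hq, smul_add, ← Int.cast_smul_eq_zsmul ℚ M,
      ← Int.cast_smul_eq_zsmul ℚ N, smul_smul, smul_smul, Int.cast_mul, mul_comm (M : ℚ)]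

theorem std_intCast_smul {R : Type} [CommRing R] (D : CommRel R n) (N : ℤ) (q : StdPoly R n) :
    D.std ((N : R) • q) = (N : D.Alg) * D.std q := by
  rw [map_smul, Algebra.smul_def, map_intCast]

/-- An element of a left ideal with integral generators is, up to an integer factor, in the left
ideal that is generated over the integers. -/
theorem exists_intCast_mul_mem_of_mem_span (hm : D.IsAdmissible m) {ι : Type*} (F : ι → D.Alg)
    {x : D.rat.Alg}
    (hx : x ∈ Ideal.span (Set.range fun k => D.mapAlg (Int.castRingHom ℚ) (F k))) :
    ∃ N : ℤ, N ≠ 0 ∧ ∃ b ∈ Ideal.span (Set.range F),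
      (N : D.rat.Alg) * x = D.mapAlg (Int.castRingHom ℚ) b := by
  induction hx using Submodule.span_induction with
  | mem x h =>
    obtain ⟨k, rfl⟩ := h
    exact ⟨1, one_ne_zero, F k, Ideal.subset_span ⟨k, rfl⟩, by rw [Int.cast_one, one_mul]⟩
  | zero => exact ⟨1, one_ne_zero, 0, zero_mem _, by rw [mul_zero, map_zero]⟩
  | add x y _ _ hx hy =>
    obtain ⟨N, hN, b, hb, e⟩ := hx
    obtain ⟨M, hM, b', hb', e'⟩ := hy
    refine ⟨N * M, mul_ne_zero hN hM, (M : D.Alg) * b + (N : D.Alg) * b',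
      add_mem (Ideal.mul_mem_left _ _ hb) (Ideal.mul_mem_left _ _ hb'), ?_⟩
    rw [map_add, map_mul, map_mul, ← e, ← e', map_intCast, map_intCast, mul_add, ← mul_assoc,
      ← mul_assoc, ← Int.cast_mul, ← Int.cast_mul, mul_comm M]
  | smul a x _ hx =>
    obtain ⟨N, hN, b, hb, e⟩ := hx
    obtain ⟨q, rfl⟩ := std_surjective (isAdmissible_map _ D hm) a
    obtain ⟨M, hM, q', e'⟩ := exists_smul_eq_map_intCast q
    refine ⟨M * N, mul_ne_zero hM hN, D.std q' * b, Ideal.mul_mem_left _ _ hb, ?_⟩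
    -- Integers are central, so the denominator of `x` can be moved past the left multiplier.
    have hcomm := (Int.cast_commute N (D.rat.std q)).eq
    rw [map_mul, ← e, mapAlg_std, ← e', std_intCast_smul, smul_eq_mul, Int.cast_mul,
      mul_assoc, mul_assoc, ← mul_assoc (D.rat.std q), ← hcomm, mul_assoc]

end Integral

variable {n : ℕ} {D : CommRel ℤ n} {m : MonomialOrder (Fin n)}

theorem intCast_map_ne_zero {q : StdPoly ℤ n} (hq : q ≠ 0) :
    MvPolynomial.map (Int.castRingHom ℚ) q ≠ 0 :=
  (map_ne_zero_iff _ (MvPolynomial.map_injective _ Int.cast_injective)).2 hq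

theorem degree_map_intCast (q : StdPoly ℤ n) :
    m.degree (MvPolynomial.map (Int.castRingHom ℚ) q) = m.degree q := by
  rw [MonomialOrder.degree, MonomialOrder.degree,
    MvPolynomial.support_map_of_injective _ Int.cast_injective]

/-- Every exponent of an ideal with integral generators is the exponent of an element of the left
ideal that is generated over the integers. -/
theorem exists_std_mem_span_of_mem_exps (hm : D.IsAdmissible m)
    (hinj : Function.Injective D.rat.std) {κ : Type*} (F : κ → D.Alg) {α : Fin n →₀ ℕ}
    (hα : α ∈ D.rat.exps m
      (Ideal.span (Set.range fun k => D.mapAlg (Int.castRingHom ℚ) (F k)) : Ideal D.rat.Alg)) :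
    ∃ a : ℤ, a ≠ 0 ∧ ∃ q ∈ below ℤ m α,
      D.std (MvPolynomial.monomial α a + q) ∈ Ideal.span (Set.range F) := by
  obtain ⟨f, hf, hf0, q, rfl, rfl⟩ := hα
  obtain ⟨N, hN, b, hb, e⟩ := exists_intCast_mul_mem_of_mem_span D hm F hf
  obtain ⟨q', rfl⟩ := std_surjective hm b
  rw [mapAlg_std, ← std_intCast_smul] at e
  -- Linear independence over ℚ turns the identity in the algebra into one of coefficients, so
  -- leading exponents can be compared.
  have e := hinj e
  have hN' : (N : ℚ) ≠ 0 := Int.cast_ne_zero.2 hN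
  have hq0 : q ≠ 0 := fun h => hf0 (by rw [h, map_zero])
  have hd : m.degree q' = m.degree q := by
    rw [← degree_map_intCast, ← e, m.degree_smul_of_isRegular (IsRegular.of_ne_zero hN')]
  have hq'0 : q' ≠ 0 := by
    rintro rfl
    rw [map_zero] at e
    exact smul_ne_zero hN' hq0 e
  obtain ⟨r, hr, e'⟩ := exists_eq_monomial_add (m := m) q'
  rw [hd] at hr e'
  exact ⟨_, m.leadingCoeff_ne_zero_iff.2 hq'0, r, hr, e' ▸ hb⟩

/-! ### Reduction modulo a good prime. -/

section Modular

variable {p : ℕ} [Fact p.Prime] {J : Ideal D.Alg} {I : Ideal D.rat.Alg}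

/-- Pseudo-division by elements of `J`, by induction on the leading exponent. The hypothesis `hE`
supplies at each stage a divisor whose leading coefficient is a unit mod p. -/
theorem map_mem_and_degree_mem (hinj : Function.Injective D.rat.std)
    {P : Ideal (D.red p).Alg}
    (hJI : ∀ b ∈ J, D.mapAlg (Int.castRingHom ℚ) b ∈ I)
    (hJP : ∀ b ∈ J, D.mapAlg (Int.castRingHom (ZMod p)) b ∈ P)
    (hE : ∀ α ∈ D.rat.exps m (I : Set D.rat.Alg), ∃ a : ℤ, ¬ (p : ℤ) ∣ a ∧ ∃ q ∈ below ℤ m α,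
      D.std (MvPolynomial.monomial α a + q) ∈ J)
    (q : StdPoly ℤ n) (hq : D.rat.std (MvPolynomial.map (Int.castRingHom ℚ) q) ∈ I) :
    (D.red p).std (MvPolynomial.map (Int.castRingHom (ZMod p)) q) ∈ P ∧
      (MvPolynomial.map (Int.castRingHom (ZMod p)) q ≠ 0 →
        m.degree (MvPolynomial.map (Int.castRingHom (ZMod p)) q) ∈
          D.rat.exps m (I : Set D.rat.Alg)) := by
  induction q using (InvImage.wf (fun q : StdPoly ℤ n => m.toSyn (m.degree q))
    wellFounded_lt).induction with
  | _ q ih =>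
  by_cases hq0 : q = 0
  · subst hq0
    rw [map_zero, map_zero]
    exact ⟨zero_mem _, fun h => absurd rfl h⟩
  have hmem : m.degree q ∈ D.rat.exps m (I : Set D.rat.Alg) :=
    ⟨_, hq, (map_ne_zero_iff _ hinj).2 (intCast_map_ne_zero hq0), _, rfl, degree_map_intCast q⟩
  obtain ⟨a, ha, r, hr, hb⟩ := hE _ hmem
  obtain ⟨s, hs, e⟩ := exists_eq_monomial_add (m := m) q
  set l := m.leadingCoeff q with hl
  set b := MvPolynomial.monomial (m.degree q) a + r with hbdef
  have haP : (a : ZMod p) ≠ 0 := fun h => ha ((ZMod.intCast_zmod_eq_zero_iff_dvd a p).1 h)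
  -- Cross-multiplication by the leading coefficients cancels the leading terms without leaving ℤ.
  obtain ⟨q', hq'def⟩ : ∃ q', q' = a • q - l • b := ⟨_, rfl⟩
  have hq'below : q' ∈ below ℤ m (m.degree q) := by
    have e2 : q' = a • s - l • r := by
      rw [hq'def, hbdef]
      have : a • q = a • (MvPolynomial.monomial (m.degree q) l + s) := congrArg (a • ·) e
      rw [this, smul_add, smul_add, MvPolynomial.smul_monomial, MvPolynomial.smul_monomial,
        smul_eq_mul, smul_eq_mul, mul_comm l a]
      abel
    rw [e2]
    exact sub_mem (Submodule.smul_mem _ _ hs) (Submodule.smul_mem _ _ hr)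
  have hmap : ∀ {S : Type} [CommRing S] (φ : ℤ →+* S), MvPolynomial.map φ q'
      = (a : S) • MvPolynomial.map φ q - (l : S) • MvPolynomial.map φ b := by
    intro S _ φ
    rw [hq'def, map_sub, MvPolynomial.smul_eq_C_mul, MvPolynomial.smul_eq_C_mul, map_mul, map_mul,
      MvPolynomial.map_C, MvPolynomial.map_C, eq_intCast, eq_intCast,
      MvPolynomial.smul_eq_C_mul, MvPolynomial.smul_eq_C_mul]
  have hq'I : D.rat.std (MvPolynomial.map (Int.castRingHom ℚ) q') ∈ I := by
    rw [hmap, map_sub, map_smul, map_smul, ← mapAlg_std _ D b]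
    exact sub_mem (smul_mem_ideal I _ hq) (smul_mem_ideal I _ (hJI _ hb))
  have key : (D.red p).std (MvPolynomial.map (Int.castRingHom (ZMod p)) q') ∈ P ∧
      (MvPolynomial.map (Int.castRingHom (ZMod p)) q' ≠ 0 →
        m.degree (MvPolynomial.map (Int.castRingHom (ZMod p)) q') ∈
          D.rat.exps m (I : Set D.rat.Alg)) := by
    by_cases h0 : q' = 0
    · rw [h0, map_zero, map_zero]
      exact ⟨zero_mem _, fun h => absurd rfl h⟩
    · exact ih q' (mem_below.1 hq'below _ (m.degree_mem_support h0)) hq'I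
  rw [hmap] at key
  constructor
  · have h1 := add_mem key.1 (smul_mem_ideal P (l : ZMod p) (hJP _ hb))
    rw [map_sub, map_smul, map_smul, mapAlg_std, sub_add_cancel] at h1
    have h2 := smul_mem_ideal P (a : ZMod p)⁻¹ h1
    rwa [smul_smul, inv_mul_cancel₀ haP, one_smul] at h2
  · intro hne
    -- If p divides the leading coefficient of `q`, then `q'` and `a • q` have the same reduction
    -- and the induction hypothesis applies; otherwise the leading exponent survives.
    by_cases hlP : (l : ZMod p) = 0
    · have := key.2
      rw [hlP, zero_smul, sub_zero,
        m.degree_smul_of_isRegular (IsRegular.of_ne_zero haP)] at this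
      exact this (smul_ne_zero haP hne)
    · have : MvPolynomial.map (Int.castRingHom (ZMod p)) q
          = MvPolynomial.monomial (m.degree q) (l : ZMod p)
            + MvPolynomial.map (Int.castRingHom (ZMod p)) s := by
        conv_lhs => rw [e]
        rw [map_add, MvPolynomial.map_monomial, eq_intCast]
      rw [this, degree_monomial_add (map_mem_below _ hs) hlP]
      exact hmem

/-- For ⊆, the elements of `J` from `hE` keep their leading exponents mod p. For ⊇, an element of
`P` lifts to `J`, hence to an integral element of `I`, to which the pseudo-division applies. -/
theorem exps_eq_of_forall_exists (hm : D.IsAdmissible m) (hinj : Function.Injective D.rat.std)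
    (hinjP : Function.Injective (D.red p).std) {P : Ideal (D.red p).Alg}
    (hJI : ∀ b ∈ J, D.mapAlg (Int.castRingHom ℚ) b ∈ I)
    (hJP : ∀ b ∈ J, D.mapAlg (Int.castRingHom (ZMod p)) b ∈ P)
    (hPJ : ∀ x ∈ P, ∃ b ∈ J, D.mapAlg (Int.castRingHom (ZMod p)) b = x)
    (hE : ∀ α ∈ D.rat.exps m (I : Set D.rat.Alg), ∃ a : ℤ, ¬ (p : ℤ) ∣ a ∧ ∃ q ∈ below ℤ m α,
      D.std (MvPolynomial.monomial α a + q) ∈ J) :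
    D.rat.exps m (I : Set D.rat.Alg) = (D.red p).exps m (P : Set (D.red p).Alg) := by
  ext α
  constructor
  · intro hα
    obtain ⟨a, ha, r, hr, hb⟩ := hE α hα
    have haP : (a : ZMod p) ≠ 0 := fun h => ha ((ZMod.intCast_zmod_eq_zero_iff_dvd a p).1 h)
    have h := hJP _ hb
    rw [mapAlg_std, map_add, MvPolynomial.map_monomial, eq_intCast] at h
    have hr' := map_mem_below (Int.castRingHom (ZMod p)) hr
    exact ⟨_, h, (map_ne_zero_iff _ hinjP).2 (monomial_add_ne_zero hr' haP), _, rfl,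
      degree_monomial_add hr' haP⟩
  · rintro ⟨f, hf, hf0, q, rfl, rfl⟩
    obtain ⟨b, hb, e⟩ := hPJ _ hf
    obtain ⟨q', rfl⟩ := std_surjective hm b
    rw [mapAlg_std] at e
    rw [← hinjP e]
    refine (map_mem_and_degree_mem hinj hJI hJP hE q' ?_).2 ?_
    · rw [← mapAlg_std]
      exact hJI _ hb
    · intro h0
      rw [h0, map_zero] at e
      exact hf0 e.symm

end Modular

theorem exists_mem_span_of_mem_span_image {A B κ : Type*} [Ring A] [Ring B] {π : A →+* B}
    (hπ : Function.Surjective π) (F : κ → A) {x : B}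
    (hx : x ∈ Ideal.span (Set.range fun k => π (F k))) :
    ∃ b ∈ Ideal.span (Set.range F), π b = x := by
  induction hx using Submodule.span_induction with
  | mem x h => obtain ⟨k, rfl⟩ := h; exact ⟨F k, Ideal.subset_span ⟨k, rfl⟩, rfl⟩
  | zero => exact ⟨0, zero_mem _, map_zero _⟩
  | add x y _ _ hx hy =>
    obtain ⟨b, hb, rfl⟩ := hx
    obtain ⟨b', hb', rfl⟩ := hy
    exact ⟨b + b', add_mem hb hb', map_add _ _ _⟩
  | smul a x _ hx =>
    obtain ⟨b, hb, rfl⟩ := hx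
    obtain ⟨a', rfl⟩ := hπ a
    exact ⟨a' * b, Ideal.mul_mem_left _ _ hb, map_mul _ _ _⟩

theorem map_mem_span_image {A B κ : Type*} [Ring A] [Ring B] (π : A →+* B) (F : κ → A) {x : A}
    (hx : x ∈ Ideal.span (Set.range F)) : π x ∈ Ideal.span (Set.range fun k => π (F k)) := by
  have : Ideal.span (Set.range F) ≤ (Ideal.span (Set.range fun k => π (F k))).comap π := by
    rw [Ideal.span_le]
    rintro _ ⟨k, rfl⟩
    exact Ideal.subset_span ⟨k, rfl⟩
  exact this hx

theorem finite_setOf_dvd {T : Set ℤ} (hT : T.Finite) (h0 : (0 : ℤ) ∉ T) :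
    {p : ℕ | ∃ x ∈ T, (p : ℤ) ∣ x}.Finite := by
  have : {p : ℕ | ∃ x ∈ T, (p : ℤ) ∣ x} ⊆ ⋃ x ∈ T, (x.natAbs.divisors : Set ℕ) := by
    rintro p ⟨x, hx, hp⟩
    refine Set.mem_biUnion hx ?_
    have : x ≠ 0 := fun h => h0 (h ▸ hx)
    simpa [this] using Int.natCast_dvd.1 hp
  exact (hT.biUnion fun x _ => Finset.finite_toSet _).subset this

theorem not_dvd_of_mem_cMonoid {p : ℕ} (hp : p.Prime)
    (h : ∀ i j : Fin n, i < j → ¬ (p : ℤ) ∣ D.c i j) {c : ℤ} (hc : c ∈ D.cMonoid) :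
    ¬ (p : ℤ) ∣ c := by
  have hp' : Prime (p : ℤ) := Nat.prime_iff_prime_int.1 hp
  induction hc using Submonoid.closure_induction with
  | mem x hx => obtain ⟨i, j, hij, rfl⟩ := hx; exact h i j hij
  | one => exact hp'.not_dvd_one
  | mul x y _ _ hx hy => exact hp'.not_dvd_mul hx hy

/-- By linear independence over ℚ an integral element has only one integral coefficient family, so
its reduction is unambiguous. -/
theorem idealTilde_eq_span (hinj : Function.Injective D.rat.std) (p : ℕ) {r : ℕ}
    (q : Fin r → StdPoly ℤ n) :
    D.idealTilde p (fun k => D.mapAlg (Int.castRingHom ℚ) (D.std (q k))) =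
      Ideal.span (Set.range fun k => D.mapAlg (Int.castRingHom (ZMod p)) (D.std (q k))) := by
  unfold idealTilde reductionSpan
  congr 1
  ext g
  constructor
  · rintro ⟨_, ⟨⟨k, rfl⟩, -⟩, q', h1, rfl⟩
    refine ⟨k, ?_⟩
    dsimp only at h1 ⊢
    rw [mapAlg_std] at h1 ⊢
    rw [MvPolynomial.map_injective _ Int.cast_injective (hinj h1)]
  · rintro ⟨k, rfl⟩
    exact ⟨_, ⟨⟨k, rfl⟩, q k, (mapAlg_std _ _ _).symm⟩, q k, (mapAlg_std _ _ _).symm,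
      (mapAlg_std _ _ _).symm⟩

end CommRel

end GAlg

end

/-! ### The lemma on unlucky primes. -/

open GAlg GAlg.CommRel in
theorem lemma3p4 (n : ℕ) (D : GAlg.CommRel ℤ n) (hD : D.rat.IsGAlgebra)
    (m : MonomialOrder (Fin n)) (hm : D.rat.IsAdmissible m)
    (I : Ideal D.rat.Alg) (hI : I ≠ ⊥)
    (r : ℕ) (f : Fin r → D.rat.Alg) (hf : ∀ k, f k ∈ D.integral)
    (hspan : Ideal.span (Set.range f) = I) :
    {p : ℕ | p.Prime ∧ ¬ (D.Star p ∧ D.IsLucky m I f p)}.Finite := by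
  have hmZ : D.IsAdmissible m := isAdmissible_of_map _ D Int.cast_injective hm
  -- Nondegeneracy descends from ℚ to ℤ, from where it can be reduced modulo every prime.
  have hnZ : ∀ i j k : Fin n, i < j → j < k → D.ReducesToZero (D.nondeg i j k) := by
    intro i j k hij hjk
    refine reducesToZero_of_map (Int.castRingHom ℚ) D Int.cast_injective ?_
    rw [mapFree_nondeg]
    exact hD.nondegenerate i j k hij hjk
  have hinj : Function.Injective D.rat.std := std_injective hm hD.nondegenerate
  choose q hq using hf
  obtain rfl : f = fun k => D.mapAlg (Int.castRingHom ℚ) (D.std (q k)) := by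
    funext k
    rw [mapAlg_std, hq]
  subst hspan
  set I := Ideal.span (Set.range fun k => D.mapAlg (Int.castRingHom ℚ) (D.std (q k))) with hIdef
  set J := Ideal.span (Set.range fun k => D.std (q k)) with hJdef
  set E := D.rat.exps m (I : Set D.rat.Alg) with hEdef
  have hmin : {α | Minimal (· ∈ E) α}.Finite :=
    WellQuasiOrderedLE.finite_of_isAntichain (setOfPred_minimal_antichain _)
  have hgen : ∀ α : {α | Minimal (· ∈ E) α}, ∃ a : ℤ, a ≠ 0 ∧ ∃ s ∈ below ℤ m α.1,
      D.std (MvPolynomial.monomial α.1 a + s) ∈ J :=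
    fun α => exists_std_mem_span_of_mem_exps hmZ hinj _ α.2.prop
  choose a ha s hs hsJ using hgen
  have hc : ∀ i j : Fin n, i < j → D.c i j ≠ 0 := by
    intro i j hij h0
    refine hD.c_ne_zero i j hij ?_
    change Int.castRingHom ℚ (D.c i j) = 0
    rw [h0, map_zero]
  -- The unlucky primes are among the divisors of finitely many nonzero integers: the c_{ij}, the
  -- coefficients of the d_{ij}, and the leading coefficients `a` at the minimal exponents.
  let T₁ : Set ℤ := {x | ∃ i j : Fin n, i < j ∧ x = D.c i j}
  let T₂ : Set ℤ := {x | ∃ i j : Fin n, ∃ α ∈ (D.d i j).support, x = (D.d i j).coeff α}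
  have hT₁ : T₁.Finite :=
    (Set.finite_range fun ij : Fin n × Fin n => D.c ij.1 ij.2).subset
      (by rintro _ ⟨i, j, -, rfl⟩; exact ⟨(i, j), rfl⟩)
  have hT₂ : T₂.Finite := by
    refine (Set.finite_iUnion fun ij : Fin n × Fin n =>
      (D.d ij.1 ij.2).support.finite_toSet.image fun α => (D.d ij.1 ij.2).coeff α).subset ?_
    rintro _ ⟨i, j, α, hα, rfl⟩
    exact Set.mem_iUnion.2 ⟨(i, j), α, hα, rfl⟩
  have hT₃ : (Set.range a).Finite := have := hmin.to_subtype; Set.finite_range a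
  have h0 : (0 : ℤ) ∉ T₁ ∪ T₂ ∪ Set.range a := by
    rintro ((⟨i, j, hij, h⟩ | ⟨i, j, α, hα, h⟩) | ⟨α, h⟩)
    · exact hc i j hij h.symm
    · exact MvPolynomial.mem_support_iff.1 hα h.symm
    · exact ha α h
  refine (finite_setOf_dvd ((hT₁.union hT₂).union hT₃) h0).subset ?_
  rintro p ⟨hp, hbad⟩
  by_contra hgood
  apply hbad
  have hgood : ∀ x ∈ T₁ ∪ T₂ ∪ Set.range a, ¬ (p : ℤ) ∣ x := fun x hx hd => hgood ⟨x, hx, hd⟩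
  have : Fact p.Prime := ⟨hp⟩
  have hstar : D.Star p := fun i j hij =>
    ⟨hgood _ (Or.inl (Or.inl ⟨i, j, hij, rfl⟩)),
      fun α hα => hgood _ (Or.inl (Or.inr ⟨i, j, α, hα, rfl⟩))⟩
  refine ⟨hstar, ?_⟩
  have hE : ∀ α ∈ E, ∃ a : ℤ, ¬ (p : ℤ) ∣ a ∧ ∃ q ∈ below ℤ m α,
      D.std (MvPolynomial.monomial α a + q) ∈ J := by
    intro α hα
    obtain ⟨β, hβα, hβ⟩ := exists_minimal_le_of_wellFoundedLT (· ∈ E) α hα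
    obtain ⟨γ, rfl⟩ := exists_add_of_le hβα
    -- The element for the minimal exponent `β` is multiplied by x^γ; its new leading coefficient is
    -- `c * a`, with `c` a product of c_{ij}, hence prime to p.
    obtain ⟨c, hcm, t, ht, e⟩ := exists_std_monomial_mul_std hmZ γ β (a ⟨β, hβ⟩) (hs ⟨β, hβ⟩)
    rw [add_comm γ β] at ht e
    refine ⟨_, ?_, t, ht, e ▸ Ideal.mul_mem_left _ _ (hsJ ⟨β, hβ⟩)⟩
    exact (Nat.prime_iff_prime_int.1 hp).not_dvd_mul
      (not_dvd_of_mem_cMonoid hp (fun i j hij => (hstar i j hij).1) hcm)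
      (hgood _ (Or.inr ⟨_, rfl⟩))
  have hmP : (D.red p).IsAdmissible m := isAdmissible_map _ D hmZ
  have hinjP : Function.Injective (D.red p).std := std_injective hmP fun i j k hij hjk => by
    rw [← mapFree_nondeg]
    exact reducesToZero_map _ D (hnZ i j k hij hjk)
  have hcP : ∀ i j : Fin n, i < j → (D.red p).c i j ≠ 0 := fun i j hij h =>
    (hstar i j hij).1 ((ZMod.intCast_zmod_eq_zero_iff_dvd _ p).1 h)
  have htilde := idealTilde_eq_span hinj p q
  have hJI : ∀ b ∈ J, D.mapAlg (Int.castRingHom ℚ) b ∈ I := fun b hb =>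
    map_mem_span_image _ _ hb
  have hJP : ∀ b ∈ J, D.mapAlg (Int.castRingHom (ZMod p)) b ∈
      D.idealTilde p fun k => D.mapAlg (Int.castRingHom ℚ) (D.std (q k)) := fun b hb => by
    rw [htilde]
    exact map_mem_span_image _ _ hb
  have hexps := exps_eq_of_forall_exists hmZ hinj hinjP hJI hJP (fun x hx => by
    rw [htilde] at hx
    exact exists_mem_span_of_mem_span_image
      (mapAlg_surjective _ D (ZMod.ringHom_surjective _) hmZ) _ hx) hE
  refine ⟨le_antisymm ?_ ?_, exists_isReducedGroebnerBasis hm hinj hD.c_ne_zero I,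
    exists_isReducedGroebnerBasis hmP hinjP hcP _, fun G₀ Gp hG₀ hGp => ?_⟩
  · refine Ideal.span_le.2 ?_
    rintro _ ⟨_, ⟨hxI, -⟩, t, rfl, rfl⟩
    exact (map_mem_and_degree_mem hinj hJI hJP hE t hxI).1
  · refine Ideal.span_mono ?_
    rintro _ ⟨x, ⟨⟨k, rfl⟩, hx⟩, h⟩
    exact ⟨_, ⟨Ideal.subset_span ⟨k, rfl⟩, hx⟩, h⟩
  · rw [exps_eq_of_isReducedGroebnerBasis hinj hG₀, exps_eq_of_isReducedGroebnerBasis hinjP hGp,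
      hexps]
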